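/- **Notation.** For a set $X$ let $X^{-1}$ be a disjoint copy of $X$, let $e\notin X\cup X^{-1}$ and $\overline X=X\cup X^{-1}\cup\{e\}$, with $(x^{-1})^{-1}=x$ and $e^{-1}=e$. Let $d$ be a metric on $\overline X$ with $d(x^{-1},y^{-1})=d(x,y)$. A *scale* on $\overline X$ is a function $\Gamma:\overline X\times[0,\infty)\to[0,\infty)$ such that for all $x\in\overline X$, $r\ge 0$: $\Gamma(e,r)=r$; $\Gamma(x,r)\ge r$; $\Gamma(x,r)=0$ iff $r=0$; $\Gamma(x,\cdot)$ is nondecreasing; and $\lim_{r\to0}\Gamma(x,r)=0$. A *match* on $\{m,\dots,n\}$ is a bijection $\theta$ of this set with $\theta\circ\theta=\mathrm{id}$ such that there are no $i,j$ with $i<j<\theta(i)<\theta(j)$. For a nonempty word $w$ over $\overline X$ of length $l+1$ and a match $\theta$ on $\{0,\dots,l\}$, define $N_\Gamma^\theta(w)$ recursively (identifying matches on shifted intervals): - if $l=0$ and $w=x$, then $N_\Gamma^\theta(w)=d(e,x)$; if $l=1$, $\theta(0)=1$ and $w=x^{-1}y$, then $N_\Gamma^\theta(w)=d(x,y)$;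 - if $l>0$ and $\theta(0)=k<l$, then $N_\Gamma^\theta(w)=N_\Gamma^{\theta_1}(w_1)+N_\Gamma^{\theta_2}(w_2)$, where $w=w_1w_2$, $w_1$ has length $k+1$, and $\theta_1,\theta_2$ are the restrictions of $\theta$ to $\{0,\dots,k\}$ and $\{k+1,\dots,l\}$; - if $l>1$, $\theta(0)=l$ and $w=x^{-1}w_1y$, then $N_\Gamma^\theta(w)=d(x,y)+\min\{\Gamma(x,N_\Gamma^{\theta_1}(w_1)),\Gamma(y,N_\Gamma^{\theta_1}(w_1))\}$, where $\theta_1$ is the restriction of $\theta$ to $\{1,\dots,l-1\}$. For $g,h$ in the free group $F(X)$ put $N_\Gamma(g)=\inf\{N_\Gamma^\theta(w): w \text{ is a nonempty word representing } g,\ \theta\text{ a match}\}$, $\delta_\Gamma(g,h)=N_\Gamma(g^{-1}h)$ and $\Delta_\Gamma(g,h)=\max\{\delta_\Gamma(g,h),\delta_\Gamma(g^{-1},h^{-1})\}$. Let $\overline F_\Gamma(X)$ be the completion of $F(X)$ with respect to the metric $\Delta_\Gamma$, with the group operations extended continuously. For $n\in\mathbb N$ let $\mathcal N_n=\{x\in\mathbb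 N^{\mathbb N}: x(m)=0\text{ for all }m\ge n\}$ and $\mathcal N_\omega=\bigcup_n\mathcal N_n$. On $\overline{\mathcal N}_\omega$ let $d(x,y)=d(x^{-1},y^{-1})=\max\{2^{-n}:x(n)\ne y(n)\}$ for distinct $x,y\in\mathcal N_\omega$, and $d(x,e)=d(x^{-1},e)=d(x,y^{-1})=1$ for all $x,y\in\mathcal N_\omega$. A Polish group is *surjectively universal* if every Polish group is isomorphic, as a topological group, to a topological quotient group of it. **Theorem.** Let $\Gamma$ be a scale on $\overline{\mathcal N}_\omega$ with $\Gamma(x,r)=\Gamma(x^{-1},r)$ for all $x\in\mathcal N_\omega$, $r\ge0$. Suppose there is $K\in\mathbb N$ such that for all integers $m>0$ and $k>m+K+5$: - (S1) for all $x\in\mathcal N_m\setminus\mathcal N_{m-1}$ and $r>2^{-(m+K+5)}$ there is $y\in\mathcal N_{m-1}$ with $\Gamma(x,r)\ge\min\{2^{-(K+3)},\ \Gamma(y,r)+2^{-K}d(x,y)\}$; - (S2) the set $E_m^k$ of all $x\in\mathcal N_m\setminus\mathcal N_{m-1}$ for which there is $r\in(2^{-k},2^{-(m+K+5)}]$ such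 that $\Gamma(x,r)<\min\{2^{-(K+3)},\ \Gamma(y,r)+2^{-K}d(x,y)\}$ for all $y\in\mathcal N_{m-1}$, is finite; - (S3) $\Gamma(x,r)\ge 8r$ for all $x\in\mathcal N_m\setminus\mathcal N_{m-1}$ and $r\le2^{-(m+K+5)}$. Then $\overline F_\Gamma(\mathcal N_\omega)$ is a surjectively universal Polish group. -/

import Mathlib

open scoped NNReal Topology Uniformity
open Filter

namespace DingGao

/-! ### Letters and words -/

/-- The alphabet `X ∪ X⁻¹ ∪ {e}`. -/
inductive Letter (X : Type*) : Type _
  | one : Letter X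
  | pos : X → Letter X
  | neg : X → Letter X

namespace Letter

variable {X : Type*}

instance : One (Letter X) := ⟨Letter.one⟩

/-- The conventions `e⁻¹ = e` and `(x⁻¹)⁻¹ = x`. -/
instance : Inv (Letter X) :=
  ⟨fun a => match a with
    | .one => .one
    | .pos x => .neg x
    | .neg x => .pos x⟩

theorem inv_inv' (a : Letter X) : a⁻¹⁻¹ = a := by cases a <;> rfl

theorem inv_one' : (1 : Letter X)⁻¹ = 1 := rfl

/-- The element of the free group that is represented by a letter. -/
def toFree : Letter X → FreeGroup X
  | .one => 1
  | .pos x => FreeGroup.of x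
  | .neg x => (FreeGroup.of x)⁻¹

theorem toFree_inv (a : Letter X) : a⁻¹.toFree = a.toFree⁻¹ := by
  cases a
  · exact inv_one.symm
  · rfl
  · exact (inv_inv _).symm

end Letter

/-- The element of the free group that is represented by a word (its reduced word). -/
def eval {X : Type*} (w : List (Letter X)) : FreeGroup X := (w.map Letter.toFree).prod

theorem eval_append {X : Type*} (u v : List (Letter X)) : eval (u ++ v) = eval u * eval v := by
  simp [eval]

theorem eval_singleton {X : Type*} (x : Letter X) : eval [x] = x.toFree := by simp [eval]

theorem eval_cons {X : Type*} (x : Letter X) (u : List (Letter X)) : eval (x :: u) = x.toFree * eval u := by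
  simp [eval]

theorem eval_inv {X : Type*} (w : List (Letter X)) : eval (w.reverse.map (·⁻¹)) = (eval w)⁻¹ := by
  induction w with
  | nil => simp [eval]
  | cons x w ih =>
    rw [List.reverse_cons, List.map_append, eval_append, ih, eval_cons, mul_inv_rev,
      List.map_singleton, eval_singleton, Letter.toFree_inv]

/-- A metric on `X ∪ X⁻¹ ∪ {e}` with `d(x⁻¹, y⁻¹) = d(x, y)`. -/
class SymmetricExtension (X : Type*) extends MetricSpace (Letter X) where
  dist_inv_inv : ∀ x y : Letter X, dist x⁻¹ y⁻¹ = dist x y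

/-! ### Scales, matches, the pre-norm and the norm -/

/-- A scale on `X ∪ X⁻¹ ∪ {e}`. -/
structure Scale (X : Type*) where
  toFun : Letter X → ℝ≥0 → ℝ≥0
  one_apply : ∀ r, toFun 1 r = r
  le_apply : ∀ x r, r ≤ toFun x r
  eq_zero_iff : ∀ x r, toFun x r = 0 ↔ r = 0
  mono : ∀ x, Monotone (toFun x)
  tendsto_zero : ∀ x, Tendsto (toFun x) (𝓝 0) (𝓝 0)

instance (X : Type*) : CoeFun (Scale X) (fun _ => Letter X → ℝ≥0 → ℝ≥0) := ⟨Scale.toFun⟩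

/-- `θ` restricts to a match on `{a, …, b - 1}`: an involution of this interval without
crossing pairs (values of `θ` elsewhere are irrelevant). -/
structure IsMatch (a b : ℕ) (θ : ℕ → ℕ) : Prop where
  maps : ∀ i ∈ Set.Ico a b, θ i ∈ Set.Ico a b
  invol : ∀ i ∈ Set.Ico a b, θ (θ i) = i
  noncrossing : ∀ i ∈ Set.Ico a b, ∀ j ∈ Set.Ico a b, ¬ (i < j ∧ j < θ i ∧ θ i < θ j)

section PreNorm

variable {X : Type*} [SymmetricExtension X]

/-- The pre-norm `N_Γ^θ(w)` of a word `w` whose letters occupy the positions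
`a, a + 1, …, a + lh(w) - 1`, where `θ` is a match on these positions. The value at the empty word
(which is not a word in the definition of the norm) is a convention. -/
noncomputable def preNorm (Γ : Scale X) (θ : ℕ → ℕ) : ℕ → List (Letter X) → ℝ≥0
  | _, [] => 0
  | _, [x] => nndist 1 x
  | a, x :: z :: u =>
    if θ a - a < u.length + 1 then
      preNorm Γ θ a ((x :: z :: u).take (θ a - a + 1)) +
        preNorm Γ θ (a + (θ a - a + 1)) ((x :: z :: u).drop (θ a - a + 1))
    else if u = [] then
      nndist x⁻¹ z
    else
      nndist x⁻¹ ((z :: u).getLast (List.cons_ne_nil z u)) +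
        min (Γ x⁻¹ (preNorm Γ θ (a + 1) (z :: u).dropLast))
          (Γ ((z :: u).getLast (List.cons_ne_nil z u)) (preNorm Γ θ (a + 1) (z :: u).dropLast))
  termination_by _ w => w.length
  decreasing_by
    all_goals simp
    all_goals omega

/-- The norm `N_Γ(g) = inf {N_Γ^θ(w) : w represents g, θ a match}`. -/
noncomputable def norm (Γ : Scale X) (g : FreeGroup X) : ℝ≥0 :=
  sInf {p | ∃ (w : List (Letter X)) (θ : ℕ → ℕ), w ≠ [] ∧ eval w = g ∧
    IsMatch 0 w.length θ ∧ preNorm Γ θ 0 w = p}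

/-- The left-invariant metric `δ_Γ(g, h) = N_Γ(g⁻¹ h)`. -/
noncomputable def delta (Γ : Scale X) (g h : FreeGroup X) : ℝ≥0 := norm Γ (g⁻¹ * h)

/-- `Δ_Γ(g, h) = max {δ_Γ(g, h), δ_Γ(g⁻¹, h⁻¹)}`. -/
noncomputable def Delta (Γ : Scale X) (g h : FreeGroup X) : ℝ≥0 :=
  max (delta Γ g h) (delta Γ g⁻¹ h⁻¹)

/-! ### An inductive description of the values of the pre-norm -/

/-- `Rel Γ w p`: the number `p` is the pre-norm of the word `w` for some match. -/
inductive Rel (Γ : Scale X) : List (Letter X) → ℝ≥0 → Prop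
  | one (x : Letter X) : Rel Γ [x] (nndist 1 x)
  | two (x y : Letter X) : Rel Γ [x, y] (nndist x⁻¹ y)
  | wrap (x y : Letter X) (w : List (Letter X)) (p : ℝ≥0) : Rel Γ w p →
      Rel Γ (x :: (w ++ [y])) (nndist x⁻¹ y + min (Γ x⁻¹ p) (Γ y p))
  | append (u v : List (Letter X)) (p q : ℝ≥0) : Rel Γ u p → Rel Γ v q → Rel Γ (u ++ v) (p + q)

theorem Rel.ne_nil {Γ : Scale X} {w : List (Letter X)} {p : ℝ≥0} (h : Rel Γ w p) : w ≠ [] := by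
  induction h <;> simp_all

theorem IsMatch.inj {a b : ℕ} {θ : ℕ → ℕ} (h : IsMatch a b θ) {i j : ℕ} (hi : i ∈ Set.Ico a b)
    (hj : j ∈ Set.Ico a b) (hij : θ i = θ j) : i = j := by
  rw [← h.invol i hi, hij, h.invol j hj]

theorem IsMatch.sub {a b c d : ℕ} {θ : ℕ → ℕ} (h : IsMatch a b θ) (hc : a ≤ c) (hd : d ≤ b)
    (hm : ∀ i ∈ Set.Ico c d, θ i ∈ Set.Ico c d) : IsMatch c d θ :=
  ⟨hm, fun i hi => h.invol i ⟨hc.trans hi.1, hi.2.trans_le hd⟩,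
    fun i hi j hj => h.noncrossing i ⟨hc.trans hi.1, hi.2.trans_le hd⟩ j
      ⟨hc.trans hj.1, hj.2.trans_le hd⟩⟩

theorem IsMatch.prefix {a b : ℕ} {θ : ℕ → ℕ} (h : IsMatch a b θ) (hab : a < b) :
    IsMatch a (θ a + 1) θ := by
  have ha : a ∈ Set.Ico a b := ⟨le_rfl, hab⟩
  have h1 := h.maps a ha
  have h2 := h.invol a ha
  simp only [Set.mem_Ico] at *
  refine h.sub le_rfl (by omega) fun i hi => ?_
  simp only [Set.mem_Ico] at *
  have hi' := h.maps i ⟨by omega, by omega⟩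
  simp only [Set.mem_Ico] at *
  refine ⟨hi'.1, ?_⟩
  by_contra hlt
  have h3 := h.noncrossing a ⟨by omega, by omega⟩ i ⟨by omega, by omega⟩
  rcases eq_or_ne i a with rfl | hne
  · omega
  · rcases eq_or_ne i (θ a) with hq | hne'
    · rw [hq, h2] at hlt; omega
    · exact h3 ⟨by omega, by omega, by omega⟩

theorem IsMatch.suffix {a b : ℕ} {θ : ℕ → ℕ} (h : IsMatch a b θ) (hab : a < b) :
    IsMatch (θ a + 1) b θ := by
  have ha : a ∈ Set.Ico a b := ⟨le_rfl, hab⟩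
  have h1 := h.maps a ha
  have hp := h.prefix hab
  simp only [Set.mem_Ico] at *
  refine h.sub (by omega) le_rfl fun i hi => ?_
  simp only [Set.mem_Ico] at *
  have hib : i ∈ Set.Ico a b := ⟨by omega, by omega⟩
  have hi' := h.maps i hib
  simp only [Set.mem_Ico] at *
  refine ⟨?_, hi'.2⟩
  by_contra hlt
  have h3 := hp.maps (θ i) ⟨hi'.1, by omega⟩
  rw [h.invol i ⟨by omega, by omega⟩] at h3
  simp only [Set.mem_Ico] at *
  omega

theorem IsMatch.inner {a b : ℕ} {θ : ℕ → ℕ} (h : IsMatch a b θ) (hab : a < b) :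
    IsMatch (a + 1) (θ a) θ := by
  have ha : a ∈ Set.Ico a b := ⟨le_rfl, hab⟩
  have h1 := h.maps a ha
  have h2 := h.invol a ha
  have hp := h.prefix hab
  simp only [Set.mem_Ico] at *
  refine h.sub (by omega) (by omega) fun i hi => ?_
  simp only [Set.mem_Ico] at *
  have hi' := hp.maps i ⟨by omega, by omega⟩
  simp only [Set.mem_Ico] at *
  have n1 : θ i ≠ a := fun hq => by
    have := h.invol i ⟨by omega, by omega⟩
    rw [hq] at this; omega
  have n2 : θ i ≠ θ a := fun hq => by
    have := h.inj (i := i) (j := a) ⟨by omega, by omega⟩ ⟨by omega, by omega⟩ hq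
    omega
  omega

theorem preNorm_split (Γ : Scale X) (θ : ℕ → ℕ) (a : ℕ) (w : List (Letter X))
    (h : θ a - a + 1 < w.length) :
    preNorm Γ θ a w = preNorm Γ θ a (w.take (θ a - a + 1)) +
      preNorm Γ θ (a + (θ a - a + 1)) (w.drop (θ a - a + 1)) := by
  match w, h with
  | x :: z :: u, h =>
    rw [preNorm, if_pos (by simpa using h)]
  | [x], h => simp at h

theorem preNorm_wrap (Γ : Scale X) (θ : ℕ → ℕ) (a : ℕ) (x y : Letter X) (w : List (Letter X))
    (h : θ a = a + (w.length + 1)) :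
    preNorm Γ θ a (x :: (w ++ [y])) =
      nndist x⁻¹ y + min (Γ x⁻¹ (preNorm Γ θ (a + 1) w)) (Γ y (preNorm Γ θ (a + 1) w)) := by
  match w, h with
  | [], h =>
    simp only [List.nil_append, preNorm]
    rw [if_neg (by simp at h ⊢; omega), if_pos trivial, (Γ.eq_zero_iff x⁻¹ 0).2 rfl,
      (Γ.eq_zero_iff y 0).2 rfl]
    simp
  | z :: u, h =>
    have h' : z :: (u ++ [y]) = (z :: u) ++ [y] := rfl
    rw [List.cons_append, preNorm, if_neg (by simp at h ⊢; omega), if_neg (by simp)]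
    simp only [h', List.getLast_append_singleton, List.dropLast_concat]

theorem preNorm_congr (Γ : Scale X) {θ θ' : ℕ → ℕ} (n : ℕ) : ∀ (a : ℕ) (w : List (Letter X)),
    w.length ≤ n → (∀ i ∈ Set.Ico a (a + w.length), θ i = θ' i) →
    preNorm Γ θ a w = preNorm Γ θ' a w := by
  induction n with
  | zero => intro a w hw _; obtain rfl := List.length_eq_zero_iff.1 (Nat.le_zero.1 hw); simp [preNorm]
  | succ n ih =>
    intro a w hw hθ
    match w, hw, hθ with
    | [], _, _ => simp [preNorm]
    | [x], _, _ => simp [preNorm]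
    | x :: z :: u, hw, hθ =>
      have ha : θ a = θ' a := hθ a ⟨le_rfl, by simp⟩
      simp only [List.length_cons, Set.mem_Ico] at hw hθ
      rw [preNorm, preNorm, ← ha]
      have e3 : preNorm Γ θ (a + 1) (z :: u).dropLast = preNorm Γ θ' (a + 1) (z :: u).dropLast :=
        ih _ _ (by simp; omega) fun i hi => hθ i (by simp at hi; omega)
      rw [e3]
      split_ifs with h1 h2
      · rw [ih a _ (by simp; omega) fun i hi => hθ i (by simp at hi; omega),
          ih _ ((x :: z :: u).drop (θ a - a + 1)) (by simp; omega)
            fun i hi => hθ i (by simp at hi; omega)]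
      · rfl
      · rfl

theorem preNorm_append (Γ : Scale X) {θ : ℕ → ℕ} (n : ℕ) : ∀ (a : ℕ) (u v : List (Letter X)),
    u.length ≤ n → u ≠ [] → v ≠ [] → IsMatch a (a + u.length) θ →
    preNorm Γ θ a (u ++ v) = preNorm Γ θ a u + preNorm Γ θ (a + u.length) v := by
  induction n with
  | zero => intro a u v hu hu'; exact absurd (List.length_eq_zero_iff.1 (by omega)) hu'
  | succ n ih =>
    intro a u v hu hu' hv hm
    have hul : 0 < u.length := List.length_pos_iff.2 hu'
    have hvl : 0 < v.length := List.length_pos_iff.2 hv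
    have h1 := hm.maps a ⟨le_rfl, by omega⟩
    simp only [Set.mem_Ico] at h1
    have hsplit := preNorm_split Γ θ a (u ++ v) (by simp; omega)
    rw [List.take_append_of_le_length (by omega), List.drop_append_of_le_length (by omega)]
      at hsplit
    rw [hsplit]
    rcases eq_or_lt_of_le (show θ a - a + 1 ≤ u.length by omega) with he | hl
    · rw [he]; simp
    · rw [preNorm_split Γ θ a u hl, add_assoc]
      have hs := hm.suffix (by omega)
      have e1 : θ a + 1 = a + (θ a - a + 1) := by omega
      rw [e1] at hs
      rw [ih (a + (θ a - a + 1)) (u.drop (θ a - a + 1)) v (by simp; omega)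
        (by rw [← List.length_pos_iff]; simp; omega) hv
        (by convert hs using 1; simp; omega)]
      congr 3
      simp; omega

theorem Rel.exists_match {Γ : Scale X} {w : List (Letter X)} {p : ℝ≥0} (h : Rel Γ w p) :
    ∀ a : ℕ, ∃ θ, IsMatch a (a + w.length) θ ∧ preNorm Γ θ a w = p := by
  induction h with
  | one x =>
    intro a
    refine ⟨id, ⟨fun i hi => hi, fun i _ => rfl, fun i _ j _ hij => ?_⟩, by simp [preNorm]⟩
    simp at hij; omega
  | two x y =>
    intro a
    refine ⟨fun i => if i = a then a + 1 else a, ⟨?_, ?_, ?_⟩, ?_⟩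
    · intro i hi; simp at hi ⊢; split_ifs <;> omega
    · intro i hi; simp at hi ⊢; split_ifs <;> omega
    · intro i hi j hj; simp at hi hj ⊢; split_ifs <;> omega
    · simp [preNorm]
  | wrap x y w p _ ih =>
    intro a
    obtain ⟨θ, hm, hp⟩ := ih (a + 1)
    let θ' : ℕ → ℕ := fun i => if i = a then a + w.length + 1 else
      if i = a + w.length + 1 then a else θ i
    have h1 : θ' a = a + (w.length + 1) := by simp [θ']; omega
    have h2 : θ' (a + w.length + 1) = a := by simp [θ']
    have h3 : ∀ i ∈ Set.Ico (a + 1) (a + 1 + w.length), θ' i = θ i := by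
      intro i hi; simp at hi; simp [θ']; split_ifs <;> omega
    have h4 : ∀ i ∈ Set.Ico (a + 1) (a + 1 + w.length),
        θ' i ∈ Set.Ico (a + 1) (a + 1 + w.length) := fun i hi => by
      rw [h3 i hi]; exact hm.maps i hi
    have hc : ∀ i ∈ Set.Ico a (a + (x :: (w ++ [y])).length),
        i = a ∨ i = a + w.length + 1 ∨ i ∈ Set.Ico (a + 1) (a + 1 + w.length) := by
      intro i hi; simp at hi ⊢; omega
    refine ⟨θ', ⟨?_, ?_, ?_⟩, ?_⟩
    · intro i hi
      rcases hc i hi with rfl | rfl | hi'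
      · rw [h1]; simp
      · rw [h2]; simp
      · have := h4 i hi'; simp at this ⊢; omega
    · intro i hi
      rcases hc i hi with rfl | rfl | hi'
      · rw [h1, ← add_assoc, h2]
      · rw [h2, h1, add_assoc]
      · rw [h3 _ (h4 i hi'), h3 i hi', hm.invol i hi']
    · intro i hi j hj hij
      rcases hc i hi with rfl | rfl | hi'
      · rcases hc j hj with rfl | rfl | hj'
        · omega
        · omega
        · have := h4 j hj'; simp at this; omega
      · rw [h2] at hij; omega
      · have hi4 := h4 i hi'
        rcases hc j hj with rfl | rfl | hj'
        · simp at hi'; omega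
        · simp at hi4; omega
        · rw [h3 i hi', h3 j hj'] at hij
          exact hm.noncrossing i hi' j hj' hij
    · rw [preNorm_wrap Γ θ' a x y w h1, preNorm_congr Γ w.length (a + 1) w le_rfl h3, hp]
  | append u v p q hu hv ihu ihv =>
    intro a
    obtain ⟨θ₁, hm₁, hp₁⟩ := ihu a
    obtain ⟨θ₂, hm₂, hp₂⟩ := ihv (a + u.length)
    let θ' : ℕ → ℕ := fun i => if i < a + u.length then θ₁ i else θ₂ i
    have h1 : ∀ i ∈ Set.Ico a (a + u.length), θ' i = θ₁ i := fun i hi => if_pos hi.2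
    have h2 : ∀ i ∈ Set.Ico (a + u.length) (a + u.length + v.length), θ' i = θ₂ i :=
      fun i hi => if_neg (not_lt.2 hi.1)
    have m1 : ∀ i ∈ Set.Ico a (a + u.length), θ' i ∈ Set.Ico a (a + u.length) :=
      fun i hi => by rw [h1 i hi]; exact hm₁.maps i hi
    have m2 : ∀ i ∈ Set.Ico (a + u.length) (a + u.length + v.length),
        θ' i ∈ Set.Ico (a + u.length) (a + u.length + v.length) :=
      fun i hi => by rw [h2 i hi]; exact hm₂.maps i hi
    have hc : ∀ i ∈ Set.Ico a (a + (u ++ v).length), i ∈ Set.Ico a (a + u.length) ∨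
        i ∈ Set.Ico (a + u.length) (a + u.length + v.length) := by
      intro i hi; simp at hi ⊢; omega
    have M1 : IsMatch a (a + u.length) θ' := ⟨m1,
      fun i hi => by rw [h1 _ (m1 i hi), h1 i hi, hm₁.invol i hi],
      fun i hi j hj => by rw [h1 i hi, h1 j hj]; exact hm₁.noncrossing i hi j hj⟩
    refine ⟨θ', ⟨?_, ?_, ?_⟩, ?_⟩
    · intro i hi
      rcases hc i hi with hi' | hi'
      · have := m1 i hi'; simp at this ⊢; omega
      · have := m2 i hi'; simp at this ⊢; omega
    · intro i hi
      rcases hc i hi with hi' | hi'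
      · exact M1.invol i hi'
      · rw [h2 _ (m2 i hi'), h2 i hi', hm₂.invol i hi']
    · intro i hi j hj hij
      rcases hc i hi with hi' | hi' <;> rcases hc j hj with hj' | hj'
      · exact M1.noncrossing i hi' j hj' hij
      · have := m1 i hi'; simp at this hj'; omega
      · simp at hi' hj'; omega
      · rw [h2 i hi', h2 j hj'] at hij
        exact hm₂.noncrossing i hi' j hj' hij
    · rw [preNorm_append Γ _ a u v le_rfl hu.ne_nil hv.ne_nil M1,
        preNorm_congr Γ _ a u le_rfl h1, preNorm_congr Γ _ _ v le_rfl h2, hp₁, hp₂]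

theorem Rel.of_match {Γ : Scale X} {θ : ℕ → ℕ} (n : ℕ) : ∀ (a : ℕ) (w : List (Letter X)),
    w.length ≤ n → w ≠ [] → IsMatch a (a + w.length) θ → Rel Γ w (preNorm Γ θ a w) := by
  induction n with
  | zero => intro a u hu hu'; exact absurd (List.length_eq_zero_iff.1 (by omega)) hu'
  | succ n ih =>
    intro a w hw hw' hm
    have hwl : 0 < w.length := List.length_pos_iff.2 hw'
    have h1 := hm.maps a ⟨le_rfl, by omega⟩
    simp only [Set.mem_Ico] at h1
    rcases eq_or_lt_of_le (show θ a - a + 1 ≤ w.length by omega) with he | hl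
    · obtain ⟨x, w, rfl⟩ := List.exists_cons_of_ne_nil hw'
      rcases List.eq_nil_or_concat' w with rfl | ⟨w, y, rfl⟩
      · simpa [preNorm] using Rel.one x
      · have hθ : θ a = a + (w.length + 1) := by simp at he; omega
        have hi := hm.inner (by omega)
        simp only [List.length_cons, List.length_append, List.length_nil] at hw
        rcases eq_or_ne w [] with rfl | hne
        · simp only [List.nil_append, preNorm]
          rw [if_neg (by simp at hθ ⊢; omega), if_pos trivial]
          exact Rel.two x y
        · rw [preNorm_wrap Γ θ a x y w hθ]
          refine Rel.wrap x y w _ (ih (a + 1) w (by omega) hne ?_)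
          convert hi using 1
          omega
    · rw [preNorm_split Γ θ a w hl]
      conv_lhs => rw [← List.take_append_drop (θ a - a + 1) w]
      refine Rel.append _ _ _ _ (ih _ _ (by simp; omega) ?_ ?_) (ih _ _ (by simp; omega) ?_ ?_)
      · rw [← List.length_pos_iff]; simp; omega
      · convert hm.prefix (by omega) using 1; simp; omega
      · rw [← List.length_pos_iff]; simp; omega
      · convert hm.suffix (by omega) using 1
        · omega
        · simp; omega

theorem norm_eq (Γ : Scale X) (g : FreeGroup X) :
    norm Γ g = sInf {p | ∃ w, Rel Γ w p ∧ eval w = g} := by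
  unfold norm
  congr 1
  ext p
  constructor
  · rintro ⟨w, θ, hw, rfl, hm, rfl⟩
    exact ⟨w, Rel.of_match w.length 0 w le_rfl hw (by simpa using hm), rfl⟩
  · rintro ⟨w, hw, rfl⟩
    obtain ⟨θ, hm, hp⟩ := hw.exists_match 0
    exact ⟨w, θ, hw.ne_nil, rfl, by simpa using hm, hp⟩

/-! ### Elementary properties of the norm -/

theorem norm_le {Γ : Scale X} {w : List (Letter X)} {p : ℝ≥0} (h : Rel Γ w p) :
    norm Γ (eval w) ≤ p := by
  rw [norm_eq]; exact csInf_le (OrderBot.bddBelow _) ⟨w, h, rfl⟩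

theorem exists_rel (Γ : Scale X) (g : FreeGroup X) : ∃ p w, Rel Γ w p ∧ eval w = g := by
  induction g using FreeGroup.induction_on with
  | C1 => exact ⟨_, _, Rel.one 1, eval_singleton _⟩
  | of x => exact ⟨_, _, Rel.one (.pos x), eval_singleton _⟩
  | inv_of x _ => exact ⟨_, _, Rel.one (.neg x), eval_singleton _⟩
  | mul x y hx hy =>
    obtain ⟨p, u, hu, rfl⟩ := hx
    obtain ⟨q, v, hv, rfl⟩ := hy
    exact ⟨_, _, Rel.append u v p q hu hv, eval_append u v⟩

theorem exists_rel_lt (Γ : Scale X) (g : FreeGroup X) {r : ℝ≥0} (h : norm Γ g < r) :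
    ∃ p < r, ∃ w, Rel Γ w p ∧ eval w = g := by
  rw [norm_eq] at h
  obtain ⟨p, ⟨w, hw, rfl⟩, hp⟩ := exists_lt_of_csInf_lt
    (s := {p | ∃ w, Rel Γ w p ∧ eval w = g}) (exists_rel Γ g) h
  exact ⟨p, hp, w, hw, rfl⟩

theorem norm_one (Γ : Scale X) : norm Γ 1 = 0 := by
  have h := norm_le (Rel.one (Γ := Γ) 1)
  rw [nndist_self, eval_singleton] at h
  exact le_antisymm h zero_le

theorem norm_mul_le (Γ : Scale X) (g h : FreeGroup X) :
    norm Γ (g * h) ≤ norm Γ g + norm Γ h := by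
  refine le_of_forall_pos_le_add fun ε hε => ?_
  obtain ⟨p, hp, u, hu, rfl⟩ := exists_rel_lt Γ g
    (lt_add_of_pos_right (norm Γ g) (half_pos hε))
  obtain ⟨q, hq, v, hv, rfl⟩ := exists_rel_lt Γ h
    (lt_add_of_pos_right (norm Γ h) (half_pos hε))
  rw [← eval_append]
  calc _ ≤ p + q := norm_le (Rel.append u v p q hu hv)
    _ ≤ _ := (add_lt_add hp hq).le
    _ = _ := by rw [add_add_add_comm, add_halves]

theorem nndist_inv_inv (x y : Letter X) : nndist x⁻¹ y⁻¹ = nndist x y :=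
  NNReal.coe_injective (SymmetricExtension.dist_inv_inv x y)

theorem Rel.inv {Γ : Scale X} {w : List (Letter X)} {p : ℝ≥0} (h : Rel Γ w p) :
    Rel Γ (w.reverse.map (·⁻¹)) p := by
  induction h with
  | one x =>
    rw [← nndist_inv_inv, Letter.inv_one']
    exact Rel.one x⁻¹
  | two x y =>
    have := Rel.two (Γ := Γ) y⁻¹ x⁻¹
    rwa [Letter.inv_inv', nndist_comm] at this
  | wrap x y w p _ ih =>
    have := Rel.wrap y⁻¹ x⁻¹ _ p ih
    rw [Letter.inv_inv', nndist_comm, min_comm] at this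
    simpa using this
  | append u v p q _ _ ihu ihv =>
    have := Rel.append _ _ _ _ ihv ihu
    rw [add_comm] at this
    simpa using this

theorem norm_inv (Γ : Scale X) (g : FreeGroup X) : norm Γ g⁻¹ = norm Γ g := by
  have key : ∀ g : FreeGroup X, norm Γ g⁻¹ ≤ norm Γ g := fun g => by
    refine le_of_forall_gt_imp_ge_of_dense fun r hr => ?_
    obtain ⟨p, hp, u, hu, rfl⟩ := exists_rel_lt Γ g hr
    rw [← eval_inv]
    exact (norm_le hu.inv).trans hp.le
  exact le_antisymm (key g) (by simpa using key g⁻¹)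

/-- Conjugation is continuous at the identity. -/
theorem norm_conj (Γ : Scale X) (g : FreeGroup X) : ∀ ε : ℝ≥0, 0 < ε → ∃ δ : ℝ≥0, 0 < δ ∧
    ∀ h, norm Γ h < δ → norm Γ (g⁻¹ * h * g) < ε := by
  have letter : ∀ (x : Letter X) (ε : ℝ≥0), 0 < ε → ∃ δ : ℝ≥0, 0 < δ ∧
      ∀ h, norm Γ h < δ → norm Γ (x.toFree⁻¹ * h * x.toFree) < ε := by
    intro x ε hε
    have h0 := (Γ.tendsto_zero x).eventually (gt_mem_nhds hε)
    obtain ⟨δ, hδ, hδ'⟩ := Metric.eventually_nhds_iff.1 h0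
    refine ⟨δ.toNNReal, Real.toNNReal_pos.2 hδ, fun h hh => ?_⟩
    obtain ⟨p, hp, w, hw, rfl⟩ := exists_rel_lt Γ h hh
    have hr := norm_le (Rel.wrap x⁻¹ x w p hw)
    rw [Letter.inv_inv', nndist_self, zero_add, min_self, eval_cons, eval_append, eval_singleton,
      Letter.toFree_inv, ← mul_assoc] at hr
    refine hr.trans_lt (hδ' ?_)
    rw [NNReal.dist_eq, NNReal.coe_zero, sub_zero, abs_of_nonneg p.coe_nonneg]
    exact Real.lt_toNNReal_iff_coe_lt.1 hp
  induction g using FreeGroup.induction_on with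
  | C1 => exact fun ε hε => ⟨ε, hε, fun h hh => by simpa using hh⟩
  | of x => exact letter (.pos x)
  | inv_of x _ => exact letter (.neg x)
  | mul x y hx hy =>
    intro ε hε
    obtain ⟨δ₁, h1, h1'⟩ := hy ε hε
    obtain ⟨δ₂, h2, h2'⟩ := hx δ₁ h1
    refine ⟨δ₂, h2, fun h hh => ?_⟩
    have := h1' _ (h2' h hh)
    simpa only [mul_inv_rev, mul_assoc] using this

/-! ### The completion of the free group -/

/-- The free group on `X`, to be equipped with the metric `Δ_Γ`. -/
def MetricFreeGroup (_ : Scale X) : Type _ := FreeGroup X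

instance (Γ : Scale X) : Group (MetricFreeGroup Γ) := inferInstanceAs (Group (FreeGroup X))

theorem delta_triangle (Γ : Scale X) (a b c : FreeGroup X) :
    delta Γ a c ≤ delta Γ a b + delta Γ b c := by
  unfold delta
  convert norm_mul_le Γ (a⁻¹ * b) (b⁻¹ * c) using 2
  group

theorem delta_comm (Γ : Scale X) (a b : FreeGroup X) : delta Γ a b = delta Γ b a := by
  unfold delta
  rw [← norm_inv, mul_inv_rev, inv_inv]

/-- The metric `Δ_Γ` on the free group. Only the axioms of a pseudometric are recorded, since these
suffice to form the (Hausdorff) completion. -/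
noncomputable instance (Γ : Scale X) : PseudoMetricSpace (MetricFreeGroup Γ) where
  dist g h := Delta (X := X) Γ g h
  dist_self g := by
    have h (g : FreeGroup X) : delta Γ g g = 0 := by
      unfold delta; rw [inv_mul_cancel, norm_one]
    have h' (g : FreeGroup X) : Delta Γ g g = 0 := by
      unfold Delta; rw [h, h, max_self]
    exact NNReal.coe_eq_zero.2 (h' g)
  dist_comm g h := by simp only [Delta]; rw [delta_comm Γ g h, delta_comm Γ]
  dist_triangle a b c := by
    rw [← NNReal.coe_add, NNReal.coe_le_coe]
    exact max_le ((delta_triangle Γ a b c).trans (add_le_add (le_max_left _ _) (le_max_left _ _)))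
      ((delta_triangle Γ _ _ _).trans (add_le_add (le_max_right _ _) (le_max_right _ _)))

theorem dist_lt_iff (Γ : Scale X) (g h : MetricFreeGroup Γ) (ε : ℝ≥0) :
    dist g h < ε ↔ norm (X := X) Γ (g⁻¹ * h) < ε ∧ norm (X := X) Γ (g * h⁻¹) < ε := by
  change ((max (norm (X := X) Γ (g⁻¹ * h)) (norm (X := X) Γ (g⁻¹⁻¹ * h⁻¹)) : ℝ≥0) : ℝ) < ε ↔ _
  rw [NNReal.coe_lt_coe, max_lt_iff, inv_inv]

/-- `F̄_Γ(X)`: the completion of the free group on `X` with respect to the metric `Δ_Γ`. -/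
def FreeCompletion (Γ : Scale X) : Type _ := UniformSpace.Completion (MetricFreeGroup Γ)

noncomputable instance (Γ : Scale X) : MetricSpace (FreeCompletion Γ) :=
  inferInstanceAs (MetricSpace (UniformSpace.Completion (MetricFreeGroup Γ)))

instance (Γ : Scale X) : CompleteSpace (FreeCompletion Γ) :=
  inferInstanceAs (CompleteSpace (UniformSpace.Completion (MetricFreeGroup Γ)))

namespace FreeCompletion

/-- The canonical map from the free group to its completion. -/
noncomputable def of (Γ : Scale X) (g : MetricFreeGroup Γ) : FreeCompletion Γ :=
  ((g : UniformSpace.Completion (MetricFreeGroup Γ)))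

theorem isDenseInducing_of (Γ : Scale X) : IsDenseInducing (of Γ) :=
  UniformSpace.Completion.isDenseInducing_coe

theorem uniformContinuous_of (Γ : Scale X) : UniformContinuous (of Γ) :=
  UniformSpace.Completion.uniformContinuous_coe _

theorem cauchy_comap (Γ : Scale X) (a : FreeCompletion Γ) : Cauchy (comap (of Γ) (𝓝 a)) :=
  cauchy_nhds.comap' (UniformSpace.Completion.comap_coe_eq_uniformity _).le
    ((isDenseInducing_of Γ).comap_nhds_neBot a)

/-- Multiplication maps pairs of Cauchy filters to Cauchy filters. -/
theorem cauchy_mul (Γ : Scale X) {l₁ l₂ : Filter (MetricFreeGroup Γ)} (h₁ : Cauchy l₁)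
    (h₂ : Cauchy l₂) : Cauchy (map (fun p : MetricFreeGroup Γ × MetricFreeGroup Γ => p.1 * p.2)
      (l₁ ×ˢ l₂)) := by
  have := h₁.1
  have := h₂.1
  refine Metric.cauchy_iff.2 ⟨inferInstance, fun ε hε => ?_⟩
  obtain ⟨e, rfl⟩ : ∃ e : ℝ≥0, (e : ℝ) = ε := ⟨⟨ε, hε.le⟩, rfl⟩
  have he : 0 < e := NNReal.coe_pos.1 hε
  have he3 : 0 < e / 3 := by positivity
  obtain ⟨A, hA, hA'⟩ := (Metric.cauchy_iff.1 h₁).2 ((e / 3 : ℝ≥0) : ℝ) (NNReal.coe_pos.2 he3)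
  obtain ⟨B, hB, hB'⟩ := (Metric.cauchy_iff.1 h₂).2 ((e / 3 : ℝ≥0) : ℝ) (NNReal.coe_pos.2 he3)
  obtain ⟨x₀, hx₀⟩ := h₁.1.nonempty_of_mem hA
  obtain ⟨y₀, hy₀⟩ := h₂.1.nonempty_of_mem hB
  obtain ⟨δ₁, hδ₁, hd₁⟩ := norm_conj Γ (y₀ : FreeGroup X) (e / 3) he3
  obtain ⟨δ₂, hδ₂, hd₂⟩ := norm_conj Γ ((x₀⁻¹ : MetricFreeGroup Γ) : FreeGroup X) (e / 3) he3
  obtain ⟨A₁, hA₁, hA₁'⟩ := (Metric.cauchy_iff.1 h₁).2 (δ₁ : ℝ) (NNReal.coe_pos.2 hδ₁)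
  obtain ⟨B₁, hB₁, hB₁'⟩ := (Metric.cauchy_iff.1 h₂).2 (δ₂ : ℝ) (NNReal.coe_pos.2 hδ₂)
  refine ⟨_, image_mem_map (prod_mem_prod (inter_mem hA hA₁) (inter_mem hB hB₁)), ?_⟩
  rintro _ ⟨⟨x, y⟩, ⟨⟨hx, hx1⟩, ⟨hy, hy1⟩⟩, rfl⟩ _ ⟨⟨x', y'⟩, ⟨⟨hx', hx1'⟩, ⟨hy', hy1'⟩⟩, rfl⟩
  have three : ∀ a b c : FreeGroup X, norm Γ a < e / 3 → norm Γ b < e / 3 → norm Γ c < e / 3 →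
      norm Γ (a * b * c) < e := fun a b c ha hb hc => by
    calc _ ≤ norm Γ a + norm Γ b + norm Γ c :=
          (norm_mul_le Γ _ _).trans (add_le_add_left (norm_mul_le Γ _ _) _)
      _ < e / 3 + e / 3 + e / 3 := add_lt_add (add_lt_add ha hb) hc
      _ = e := by rw [← add_div, ← add_div]; field_simp; norm_num
  refine (dist_lt_iff Γ _ _ e).2 ⟨?_, ?_⟩
  · have h1 := ((dist_lt_iff Γ _ _ _).1 (hB' y hy y₀ hy₀)).1
    have h2 := hd₁ _ ((dist_lt_iff Γ _ _ _).1 (hA₁' x hx1 x' hx1')).1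
    have h3 := ((dist_lt_iff Γ _ _ _).1 (hB' y₀ hy₀ y' hy')).1
    have := three _ _ _ h1 h2 h3
    refine lt_of_eq_of_lt (congrArg (norm (X := X) Γ) ?_) this
    change (x * y)⁻¹ * (x' * y') = (y⁻¹ * y₀) * (y₀⁻¹ * (x⁻¹ * x') * y₀) * (y₀⁻¹ * y')
    group
  · have h1 := ((dist_lt_iff Γ _ _ _).1 (hA' x hx x₀ hx₀)).2
    have h2 := hd₂ _ ((dist_lt_iff Γ _ _ _).1 (hB₁' y hy1 y' hy1')).2
    have h3 := ((dist_lt_iff Γ _ _ _).1 (hA' x₀ hx₀ x' hx')).2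
    have := three _ _ _ h1 h2 h3
    refine lt_of_eq_of_lt (congrArg (norm (X := X) Γ) ?_) this
    change (x * y) * (x' * y')⁻¹ = (x * x₀⁻¹) * (x₀⁻¹⁻¹ * (y * y'⁻¹) * x₀⁻¹) * (x₀ * x'⁻¹)
    group

theorem uniformContinuous_inv (Γ : Scale X) :
    UniformContinuous (fun g : MetricFreeGroup Γ => g⁻¹) := by
  refine Metric.uniformContinuous_iff.2 fun ε hε => ⟨ε, hε, fun g h hgh => ?_⟩
  obtain ⟨e, rfl⟩ : ∃ e : ℝ≥0, (e : ℝ) = ε := ⟨⟨ε, hε.le⟩, rfl⟩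
  have := (dist_lt_iff Γ _ _ _).1 hgh
  exact (dist_lt_iff Γ _ _ _).2 ⟨by rw [inv_inv]; exact this.2, by rw [inv_inv]; exact this.1⟩

noncomputable instance (Γ : Scale X) : One (FreeCompletion Γ) := ⟨of Γ 1⟩

/-- The continuous extension of the multiplication of the free group. -/
noncomputable instance (Γ : Scale X) : Mul (FreeCompletion Γ) :=
  ⟨fun a b => ((isDenseInducing_of Γ).prodMap (isDenseInducing_of Γ)).extend
    (fun p => of Γ (p.1 * p.2)) (a, b)⟩

/-- The continuous extension of the inversion of the free group. -/
noncomputable instance (Γ : Scale X) : Inv (FreeCompletion Γ) :=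
  ⟨(isDenseInducing_of Γ).extend (fun g => of Γ g⁻¹)⟩

theorem exists_tendsto_mul (Γ : Scale X) (p : FreeCompletion Γ × FreeCompletion Γ) :
    ∃ c, Tendsto (fun p => of Γ (p.1 * p.2)) (comap (Prod.map (of Γ) (of Γ)) (𝓝 p)) (𝓝 c) := by
  obtain ⟨a, b⟩ := p
  rw [nhds_prod_eq, Filter.comap_prodMap_prod]
  exact CompleteSpace.complete
    ((cauchy_mul Γ (cauchy_comap Γ a) (cauchy_comap Γ b)).map (uniformContinuous_of Γ))

theorem exists_tendsto_inv (Γ : Scale X) (a : FreeCompletion Γ) :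
    ∃ c, Tendsto (fun g => of Γ g⁻¹) (comap (of Γ) (𝓝 a)) (𝓝 c) :=
  CompleteSpace.complete
    (((cauchy_comap Γ a).map (uniformContinuous_inv Γ)).map (uniformContinuous_of Γ))

theorem continuous_mul (Γ : Scale X) :
    Continuous (fun p : FreeCompletion Γ × FreeCompletion Γ => p.1 * p.2) :=
  ((isDenseInducing_of Γ).prodMap (isDenseInducing_of Γ)).continuous_extend (exists_tendsto_mul Γ)

theorem continuous_inv (Γ : Scale X) : Continuous (fun a : FreeCompletion Γ => a⁻¹) :=
  (isDenseInducing_of Γ).continuous_extend (exists_tendsto_inv Γ)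

theorem of_mul (Γ : Scale X) (g h : MetricFreeGroup Γ) : of Γ (g * h) = of Γ g * of Γ h :=
  (((isDenseInducing_of Γ).prodMap (isDenseInducing_of Γ)).extend_eq' (exists_tendsto_mul Γ)
    (g, h)).symm

theorem of_inv (Γ : Scale X) (g : MetricFreeGroup Γ) : of Γ g⁻¹ = (of Γ g)⁻¹ :=
  ((isDenseInducing_of Γ).extend_eq' (exists_tendsto_inv Γ) g).symm

instance (Γ : Scale X) : ContinuousMul (FreeCompletion Γ) := ⟨continuous_mul Γ⟩

instance (Γ : Scale X) : ContinuousInv (FreeCompletion Γ) := ⟨continuous_inv Γ⟩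

/-- The group structure of the completion, which extends that of the free group continuously. -/
noncomputable instance (Γ : Scale X) : Group (FreeCompletion Γ) :=
  Group.ofLeftAxioms
    (fun a b c => (isDenseInducing_of Γ).dense.induction_on₃
      (p := fun a b c : FreeCompletion Γ => a * b * c = a * (b * c))
      (isClosed_eq (by fun_prop) (by fun_prop))
      (fun a b c => by rw [← of_mul, ← of_mul, ← of_mul, ← of_mul, mul_assoc]) a b c)
    (fun a => (isDenseInducing_of Γ).dense.induction_on
      (p := fun a : FreeCompletion Γ => 1 * a = a) a
      (isClosed_eq (by fun_prop) (by fun_prop))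
      (fun a => by
        change of Γ 1 * of Γ a = of Γ a
        rw [← of_mul, one_mul]))
    (fun a => (isDenseInducing_of Γ).dense.induction_on
      (p := fun a : FreeCompletion Γ => a⁻¹ * a = 1) a
      (isClosed_eq (by fun_prop) (by fun_prop))
      (fun a => by
        change (of Γ a)⁻¹ * of Γ a = of Γ 1
        rw [← of_inv, ← of_mul, inv_mul_cancel]))

end FreeCompletion

end PreNorm

/-! ### Finitely supported sequences in the Baire space -/

/-- The set `𝒩_n` of all sequences `x` with `x(m) = 0` for all `m ≥ n`. -/
def level (n : ℕ) : Set (ℕ → ℕ) := {x | ∀ m, n ≤ m → x m = 0}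

/-- The set `𝒩_ω = ⋃ n, 𝒩_n`. -/
def NOmega : Type := {x : ℕ → ℕ // x ∈ ⋃ n, level n}

/-- The metric of the Baire space: `d(x, y) = max {2 ^ (-n) : x(n) ≠ y(n)}` for `x ≠ y`, that is,
`2 ^ (-n)` for the least `n` with `x(n) ≠ y(n)`. -/
noncomputable def baireDist (x y : ℕ → ℕ) : ℝ := PiNat.dist.dist x y

theorem baireDist_isGreatest {x y : ℕ → ℕ} (h : x ≠ y) :
    IsGreatest {r : ℝ | ∃ n, x n ≠ y n ∧ r = (2 : ℝ)⁻¹ ^ n} (baireDist x y) := by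
  have e : baireDist x y = (2 : ℝ)⁻¹ ^ PiNat.firstDiff x y := by
    rw [baireDist, PiNat.dist_eq_of_ne h, one_div]
  refine ⟨⟨_, PiNat.apply_firstDiff_ne h, e⟩, ?_⟩
  rintro _ ⟨n, hn, rfl⟩
  rw [e]
  refine pow_le_pow_of_le_one (by norm_num) (by norm_num) ?_
  by_contra hlt
  exact hn (PiNat.apply_eq_of_lt_firstDiff (not_le.1 hlt))

/-- The extension of the metric to the alphabet `𝒩_ω ∪ 𝒩_ω⁻¹ ∪ {e}`. -/
noncomputable def letterDist : Letter NOmega → Letter NOmega → ℝ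
  | .pos x, .pos y => baireDist x.1 y.1
  | .neg x, .neg y => baireDist x.1 y.1
  | .one, .one => 0
  | _, _ => 1

noncomputable instance : SymmetricExtension NOmega where
  dist := letterDist
  dist_self a := by
    cases a <;> simp [letterDist, baireDist, PiNat.dist_self]
  dist_comm a b := by
    cases a <;> cases b <;> simp [letterDist, baireDist, PiNat.dist_comm]
  dist_triangle a b c := by
    have h0 : ∀ x y : NOmega, 0 ≤ baireDist x.1 y.1 := fun x y => PiNat.dist_nonneg _ _
    have h1 : ∀ x y : NOmega, baireDist x.1 y.1 ≤ 1 := fun x y => PiNat.dist_le_one _ _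
    rcases a with _ | a | a <;> rcases b with _ | b | b <;> rcases c with _ | c | c <;>
      simp only [letterDist]
    all_goals first
      | exact PiNat.dist_triangle _ _ _
      | norm_num; done
      | linarith [h0 a b, h1 a b]
      | linarith [h0 a c, h1 a c]
      | linarith [h0 b c, h1 b c]
  eq_of_dist_eq_zero {a b} h := by
    have h0 : ∀ x y : NOmega, baireDist x.1 y.1 = 0 → x = y := fun x y hxy =>
      Subtype.ext (PiNat.eq_of_dist_eq_zero _ _ hxy)
    cases a <;> cases b <;> simp only [letterDist] at h
    all_goals first
      | rfl
      | (exact absurd h one_ne_zero)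
      | (rw [h0 _ _ h])
  dist_inv_inv a b := by cases a <;> cases b <;> rfl

/-- The exceptional set `E_m^k ⊆ 𝒩_m ∖ 𝒩_{m-1}` (it depends on the constant `K`). -/
def exceptionalSet (Γ : Scale NOmega) (K m k : ℕ) : Set NOmega :=
  {x | x.1 ∈ level m \ level (m - 1) ∧
    ∃ r : ℝ≥0, r ∈ Set.Ioc (2⁻¹ ^ k) (2⁻¹ ^ (m + K + 5)) ∧
      ∀ y : NOmega, y.1 ∈ level (m - 1) →
        Γ (.pos x) r <
          min (2⁻¹ ^ (K + 3)) (Γ (.pos y) r + 2⁻¹ ^ K * nndist (Letter.pos x) (Letter.pos y))}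

universe u v

/-- A Polish group: a topological group whose underlying space is Polish. -/
structure IsPolishGroup (G : Type u) [Group G] [TopologicalSpace G] : Prop where
  isTopologicalGroup : IsTopologicalGroup G
  polishSpace : PolishSpace G

/-- `G` is surjectively universal: it is a Polish group, and every Polish group `H` is isomorphic,
as a topological group, to a topological quotient group of `G`. -/
structure IsSurjectivelyUniversal (G : Type u) [Group G] [TopologicalSpace G] : Prop where
  isPolishGroup : IsPolishGroup G
  exists_quotient : ∀ (H : Type v) [Group H] [TopologicalSpace H], IsPolishGroup H →
    ∃ (N : Subgroup G) (_ : N.Normal), Nonempty ((G ⧸ N) ≃ₜ* H)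

end DingGao

universe v

/-! Given a Polish group H with dense sequence D, it suffices to find a continuous open surjective
homomorphism F from the completion onto H; its kernel then gives the quotient. F extends the
homomorphism of the free group that sends a finitely supported sequence x to a coded element of H: x
is read as instructions for walking through D by smaller and smaller steps.

Continuity of F comes from a maximality property of the norm (`length_le_norm`): if a length ℓ on H
is 1-Lipschitz along letters and conjugation by a letter is bounded by Γ, then ℓ ≤ N_Γ along the
homomorphism. The length comes from a chain of neighbourhoods U n of 1 by the Birkhoff–Kakutani
construction, so that U n lies between the balls of radius 2^-(n+1) and 2^-n. The Lipschitz bound is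
built into the step sizes of the walk. The conjugation bound (`conj_code_le`) goes by induction on
the level m of x, with r = ℓ h. Where Γ(x, r) dominates the min for some y of lower level,
conjugation by x is compared with conjugation by y. By (S1) this can fail only for small r, and then
x is an exceptional point; by (S2) only finitely many values of D matter at each scale, so U can be
chosen with U (n+1) conjugated into U n by them, and the resulting loss, a factor less than 8, is
absorbed by (S3).

Surjectivity and openness hold because every h near 1 is the limit of a walk that starts with many
idle steps (`exists_tendsto_approx`); the truncations of its instruction sequence converge in the
completion to a point near the letter of the zero sequence, which F sends to 1. -/

namespace DingGao

/-! ### Left-invariant metrics and completeness of topological groups -/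

section Group

variable {H : Type*} [Group H]

/-- A length function on a group: `(g, h) ↦ ℓ (g⁻¹ * h)` is a left-invariant pseudometric. -/
structure IsLength (ℓ : H → ℝ≥0) : Prop where
  one : ℓ 1 = 0
  inv : ∀ g, ℓ g⁻¹ = ℓ g
  mul_le : ∀ g h, ℓ (g * h) ≤ ℓ g + ℓ h

/-- The Birkhoff–Kakutani construction of a length function from a chain of symmetric sets. -/
theorem exists_isLength (U : ℕ → Set H) (huniv : U 0 = Set.univ) (hone : ∀ n, 1 ∈ U n)
    (hinv : ∀ n, ∀ g ∈ U n, g⁻¹ ∈ U n)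
    (hmul : ∀ n, ∀ a ∈ U (n + 1), ∀ b ∈ U (n + 1), ∀ c ∈ U (n + 1), a * b * c ∈ U n) :
    ∃ ℓ : H → ℝ≥0, IsLength ℓ ∧ (∀ n, ∀ h ∈ U n, ℓ h ≤ 2⁻¹ ^ n) ∧
      ∀ n h, ℓ h ≤ 2⁻¹ ^ (n + 1) → h ∈ U n := by
  classical
  have hanti : Antitone U := antitone_nat_of_succ_le fun n h hh => by
    simpa using hmul n h hh 1 (hone _) 1 (hone _)
  have hr0 : (0 : ℝ≥0) < 2⁻¹ := by positivity
  have hr1 : (2⁻¹ : ℝ≥0) < 1 := by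
    rw [← NNReal.coe_lt_coe]; norm_num
  -- The value is 2^-n for h in U n but not in U (n+1), and 0 for h in every U n. Passing to infima
  -- over chains will restore the triangle inequality.
  let ρ : H → ℝ≥0 := fun h => if hh : ∃ n, h ∉ U (n + 1) then 2⁻¹ ^ Nat.find hh else 0
  have hρ : ∀ {h : H} {n : ℕ}, 2⁻¹ ^ n ≤ ρ h ↔ h ∉ U (n + 1) := by
    intro h n
    dsimp only [ρ]
    split_ifs with hh
    · rw [(pow_right_strictAnti₀ hr0 hr1).le_iff_ge, Nat.find_le_iff]
      exact ⟨fun ⟨m, hmn, hm⟩ hn => hm (hanti (Nat.succ_le_succ hmn) hn),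
        fun h => ⟨n, le_rfl, h⟩⟩
    · push Not at hh
      simp [hh]
  have hρle : ∀ n, ∀ h ∈ U n, ρ h ≤ 2⁻¹ ^ n := by
    intro n h hn
    dsimp only [ρ]
    split_ifs with hh
    · refine pow_le_pow_of_le_one hr0.le hr1.le ?_
      rw [Nat.le_find_iff]
      exact fun m hm hm' => hm' (hanti (Nat.succ_le_of_lt hm) hn)
    · exact zero_le
  have hρinv : ∀ h, ρ h⁻¹ = ρ h := by
    have e : ∀ h n, h⁻¹ ∉ U (n + 1) ↔ h ∉ U (n + 1) := fun h n =>
      not_congr ⟨fun hh => by simpa using hinv _ _ hh, hinv _ _⟩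
    intro h
    simp only [ρ, e]
  have hρone : ρ 1 = 0 := by simp [ρ, hone]
  let d : H → H → ℝ≥0 := fun g h => ρ (g⁻¹ * h)
  have hd0 : ∀ g, d g g = 0 := fun g => by simp [d, hρone]
  have hdc : ∀ g h, d g h = d h g := fun g h => by
    dsimp only [d]; rw [← hρinv, mul_inv_rev, inv_inv]
  -- This weak inequality for three consecutive steps is what limits the loss in passing to chains
  -- to a factor 2; it encodes the threefold product condition.
  have hd3 : ∀ x₁ x₂ x₃ x₄, d x₁ x₄ ≤ 2 * max (d x₁ x₂) (max (d x₂ x₃) (d x₃ x₄)) := by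
    intro x₁ x₂ x₃ x₄
    by_cases hh : ∃ n, x₁⁻¹ * x₄ ∉ U (n + 1)
    · refine (dif_pos hh).trans_le ?_
      have hspec := Nat.find_spec hh
      set n := Nat.find hh
      have key : 2⁻¹ ^ (n + 1) ≤ max (d x₁ x₂) (max (d x₂ x₃) (d x₃ x₄)) := by
        simp only [le_max_iff, d, hρ, ← not_and_or]
        rintro ⟨h₁, h₂, h₃⟩
        refine hspec ?_
        have := hmul _ _ h₁ _ h₂ _ h₃
        convert this using 1
        group
      calc (2⁻¹ : ℝ≥0) ^ n = 2 * 2⁻¹ ^ (n + 1) := by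
            rw [pow_succ, mul_comm, mul_assoc, inv_mul_cancel₀ two_ne_zero, mul_one]
        _ ≤ _ := by gcongr
    · exact (dif_neg hh).trans_le zero_le
  let I := PseudoMetricSpace.ofPreNNDist d hd0 hdc
  -- Left translation maps chains to chains of the same total length, so the chain metric inherits
  -- left invariance.
  have hinvar : ∀ a g h : H, nndist (a * g) (a * h) ≤ nndist g h := by
    intro a g h
    rw [← NNReal.coe_le_coe, coe_nndist, coe_nndist]
    rw [PseudoMetricSpace.dist_ofPreNNDist, PseudoMetricSpace.dist_ofPreNNDist, NNReal.coe_le_coe]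
    refine le_ciInf fun l => (ciInf_le (OrderBot.bddBelow _) (l.map (a * ·))).trans_eq ?_
    rw [← List.map_cons (f := (a * ·)), ← List.map_singleton (f := (a * ·)), ← List.map_append,
      List.zipWith_map]
    simp [d, mul_assoc]
  have hle : ∀ h, nndist 1 h ≤ ρ h := fun h => by
    have : nndist 1 h ≤ d 1 h :=
      NNReal.coe_le_coe.1 (PseudoMetricSpace.dist_ofPreNNDist_le d hd0 hdc 1 h)
    simpa only [d, inv_one, one_mul] using this
  have hge : ∀ h, ρ h ≤ 2 * nndist 1 h := fun h => by
    have : d 1 h ≤ 2 * nndist 1 h :=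
      NNReal.coe_le_coe.1 (PseudoMetricSpace.le_two_mul_dist_ofPreNNDist d hd0 hdc hd3 1 h)
    simpa only [d, inv_one, one_mul] using this
  have hinv1 : ∀ g : H, nndist 1 g⁻¹ ≤ nndist 1 g := fun g => by
    have := hinvar g⁻¹ 1 g
    rwa [mul_one, inv_mul_cancel, nndist_comm, nndist_comm 1 g, nndist_comm g 1] at this
  refine ⟨fun h => nndist 1 h, ⟨nndist_self 1, fun g => ?_, fun g h => ?_⟩,
    fun n h hh => (hle h).trans (hρle n h hh), fun n h hh => ?_⟩
  · exact le_antisymm (hinv1 g) (by simpa using hinv1 g⁻¹)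
  · refine (nndist_triangle 1 g (g * h)).trans (add_le_add le_rfl ?_)
    simpa using hinvar g 1 h
  -- For positive index, the factor 2 turns the bound 2^-(n+2) on the length into ρ h ≤ 2^-(n+1),
  -- whereas h outside U (n+1) would force ρ h ≥ 2^-n.
  · match n, hh with
    | 0, _ => rw [huniv]; trivial
    | n + 1, hh =>
      by_contra hn
      have h1 := (hρ.2 hn).trans ((hge h).trans (mul_le_mul_right hh 2))
      have h2 : (2 : ℝ≥0) * 2⁻¹ ^ (n + 1 + 1) = 2⁻¹ ^ (n + 1) := by
        rw [pow_succ _ (n + 1), mul_comm, mul_assoc, inv_mul_cancel₀ two_ne_zero, mul_one]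
      rw [h2] at h1
      exact absurd ((pow_right_strictAnti₀ hr0 hr1).le_iff_ge.1 h1) (by omega)

variable [TopologicalSpace H] [IsTopologicalGroup H]

/-- A neighbourhood base of the identity whose steps absorb conjugation by finite sets. -/
theorem exists_nhds_chain [FirstCountableTopology H] (S : ℕ → Set H) (hS : ∀ n, (S n).Finite)
    (B : ℕ) :
    ∃ U : ℕ → Set H, (∀ n ≤ B, U n = Set.univ) ∧ (∀ n, U n ∈ 𝓝 1) ∧
      (∀ n, ∀ g ∈ U n, g⁻¹ ∈ U n) ∧
      (∀ n, ∀ a ∈ U (n + 1), ∀ b ∈ U (n + 1), ∀ c ∈ U (n + 1), a * b * c ∈ U n) ∧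
      (∀ n, B ≤ n → ∀ d ∈ S n, ∀ u ∈ U (n + 1), d⁻¹ * u * d ∈ U n ∧ d * u * d⁻¹ ∈ U n) ∧
      ∀ W ∈ 𝓝 (1 : H), ∃ n, U n ⊆ W := by
  obtain ⟨A, hA⟩ := (𝓝 (1 : H)).exists_antitone_basis
  -- The finite set is taken at n + B because the chain built here is later delayed by B places.
  have step : ∀ (n : ℕ) (V : Set H), V ∈ 𝓝 1 → ∃ V' ∈ 𝓝 (1 : H), V' ⊆ A n ∧
      (∀ g ∈ V', g⁻¹ ∈ V') ∧ (∀ a ∈ V', ∀ b ∈ V', ∀ c ∈ V', a * b * c ∈ V) ∧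
      ∀ d ∈ S (n + B), ∀ u ∈ V', d⁻¹ * u * d ∈ V ∧ d * u * d⁻¹ ∈ V := by
    intro n V hV
    have h1 : Tendsto (fun p : H × H × H => p.1 * p.2.1 * p.2.2) (𝓝 1) (𝓝 1) := by
      have : Continuous (fun p : H × H × H => p.1 * p.2.1 * p.2.2) := by fun_prop
      simpa using this.tendsto 1
    have h2 := h1 hV
    rw [mem_map, Prod.one_eq_mk, Prod.one_eq_mk, nhds_prod_eq, nhds_prod_eq, mem_prod_iff] at h2
    obtain ⟨V₁, hV₁, W, hW, h2⟩ := h2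
    obtain ⟨V₂, hV₂, V₃, hV₃, h3⟩ := mem_prod_iff.1 hW
    have h4 : ∀ d ∈ S (n + B), ∀ᶠ u in 𝓝 (1 : H), d⁻¹ * u * d ∈ V ∧ d * u * d⁻¹ ∈ V := by
      intro d _
      have c1 : Tendsto (fun u : H => d⁻¹ * u * d) (𝓝 1) (𝓝 1) := by
        have : Continuous (fun u : H => d⁻¹ * u * d) := by fun_prop
        simpa using this.tendsto 1
      have c2 : Tendsto (fun u : H => d * u * d⁻¹) (𝓝 1) (𝓝 1) := by
        have : Continuous (fun u : H => d * u * d⁻¹) := by fun_prop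
        simpa using this.tendsto 1
      exact (c1.eventually hV).and (c2.eventually hV)
    have h5 := ((hS (n + B)).eventually_all).2 h4
    let P : Set H := V₁ ∩ V₂ ∩ V₃ ∩ A n ∩
      {u | ∀ d ∈ S (n + B), d⁻¹ * u * d ∈ V ∧ d * u * d⁻¹ ∈ V}
    have hP : P ∈ 𝓝 (1 : H) :=
      inter_mem (inter_mem (inter_mem (inter_mem hV₁ hV₂) hV₃) (hA.mem n)) h5
    refine ⟨P ∩ P⁻¹, inter_mem hP (inv_mem_nhds_one H hP), fun g hg => hg.1.1.2,
      fun g hg => ⟨hg.2, by simpa using hg.1⟩, fun a ha b hb c hc => ?_,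
      fun d hd u hu => hu.1.2 d hd⟩
    exact h2 (show (a, b, c) ∈ V₁ ×ˢ W from
      ⟨ha.1.1.1.1.1, h3 ⟨hb.1.1.1.1.2, hc.1.1.1.2⟩⟩)
  choose! G hG hGA hGinv hGmul hGconj using step
  let V : ℕ → Set H := fun n => Nat.rec Set.univ (fun n V => G n V) n
  have hV : ∀ n, V n ∈ 𝓝 1 := fun n => by
    induction n with
    | zero => exact univ_mem
    | succ n ih => exact hG n _ ih
  have hVinv : ∀ n, ∀ g ∈ V n, g⁻¹ ∈ V n := fun n => by
    cases n with
    | zero => exact fun _ _ => trivial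
    | succ n => exact hGinv n _ (hV n)
  -- Truncated subtraction keeps the sets equal to the whole group up to and including index B.
  refine ⟨fun n => V (n - B), fun n hn => ?_, fun n => hV _, fun n => hVinv _, fun n => ?_,
    fun n hn => ?_, fun W hW => ?_⟩
  · simp only [Nat.sub_eq_zero_of_le hn]
    rfl
  · rcases lt_or_ge n B with h | h
    · simp only [Nat.sub_eq_zero_of_le h.le]
      exact fun _ _ _ _ _ _ => trivial
    · simp only [Nat.succ_sub h]
      exact hGmul _ _ (hV _)
  · have := hGconj (n - B) _ (hV (n - B))
    rw [Nat.sub_add_cancel hn] at this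
    simp only [Nat.succ_sub hn]
    exact this
  · obtain ⟨n, hn⟩ := hA.mem_iff.1 hW
    refine ⟨n + 1 + B, ?_⟩
    simp only [Nat.add_sub_cancel]
    exact (hGA n _ (hV n)).trans hn

/-- A Polish group is complete in its two-sided uniformity. -/
theorem exists_tendsto_of_cauchy [PolishSpace H] {F : Filter H} [F.NeBot]
    (hl : Tendsto (fun p : H × H => p.1⁻¹ * p.2) (F ×ˢ F) (𝓝 1))
    (hr : Tendsto (fun p : H × H => p.1 * p.2⁻¹) (F ×ˢ F) (𝓝 1)) : ∃ c, F ≤ 𝓝 c := by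
  let _ := TopologicalSpace.upgradeIsCompletelyMetrizable H
  -- The complete metric need not be invariant, so F need not be Cauchy for it. Baire category
  -- supplies a right translate F * h that is: h must lie in every `A n`.
  let A : ℕ → Set H := fun n => {h | ∃ T ∈ F, ∃ W ∈ 𝓝 h, ∀ x ∈ T, ∀ y ∈ T, ∀ w ∈ W, ∀ w' ∈ W,
    dist (x * w) (y * w') < 1 / (n + 1 : ℝ)}
  have hopen : ∀ n, IsOpen (A n) := fun n => isOpen_iff_mem_nhds.2 fun h hh => by
    obtain ⟨T, hT, W, hW, hd⟩ := hh
    filter_upwards [eventually_mem_nhds_iff.2 hW] with g hg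
    exact ⟨T, hT, W, hg, hd⟩
  have hdense : ∀ n, Dense (A n) := by
    intro n h₀
    rw [mem_closure_iff_nhds]
    intro Q hQ
    have hpos : (0 : ℝ) < 1 / (n + 1) / 2 := by positivity
    have t1 : Tendsto (fun p : H × H => p.1⁻¹ * p.2 * h₀) (F ×ˢ F) (𝓝 h₀) := by
      simpa using hl.mul_const h₀
    obtain ⟨T₁, hT₁, hQ'⟩ := mem_prod_same_iff.1 (t1 hQ)
    obtain ⟨a, ha⟩ := nonempty_of_mem hT₁
    have t2 : Tendsto (fun p : H × H => p.1 * p.2) (𝓝 1 ×ˢ 𝓝 (a * h₀)) (𝓝 (a * h₀)) := by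
      rw [← nhds_prod_eq]
      have : Continuous (fun p : H × H => p.1 * p.2) := by fun_prop
      simpa using this.tendsto (1, a * h₀)
    obtain ⟨O, hO, O', hO', hOO⟩ := mem_prod_iff.1 (t2 (Metric.ball_mem_nhds (a * h₀) hpos))
    obtain ⟨T₂, hT₂, hTO⟩ := mem_prod_same_iff.1 (hr hO)
    obtain ⟨b, hb⟩ := nonempty_of_mem (inter_mem hT₁ hT₂)
    -- The left Cauchy condition puts this point near h₀. In x * w = (x * b⁻¹) * (b * w) the right
    -- Cauchy condition makes the first factor close to 1, and b * w is close to a * h₀ by the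
    -- choice of w, so all such products cluster at a * h₀.
    refine ⟨b⁻¹ * a * h₀, hQ' (show (b, a) ∈ T₁ ×ˢ T₁ from ⟨hb.1, ha⟩), T₂, hT₂,
      (b * ·) ⁻¹' O', ?_, ?_⟩
    · refine (continuous_const_mul b).continuousAt ?_
      simpa [mul_assoc] using hO'
    · have key : ∀ x ∈ T₂, ∀ w ∈ (b * ·) ⁻¹' O', dist (x * w) (a * h₀) < 1 / (n + 1) / 2 := by
        intro x hx w hw
        have := hOO (show (x * b⁻¹, b * w) ∈ O ×ˢ O' from
          ⟨hTO (show (x, b) ∈ T₂ ×ˢ T₂ from ⟨hx, hb.2⟩), hw⟩)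
        simpa [mul_assoc] using this
      intro x hx y hy w hw w' hw'
      linarith [dist_triangle_right (x * w) (y * w') (a * h₀), key x hx w hw, key y hy w' hw']
  obtain ⟨h, hh⟩ := (dense_iInter_of_isOpen hopen hdense).nonempty
  rw [Set.mem_iInter] at hh
  have hc : Cauchy (map (· * h) F) := by
    refine Metric.cauchy_iff.2 ⟨inferInstance, fun ε hε => ?_⟩
    obtain ⟨n, hn⟩ := exists_nat_one_div_lt hε
    obtain ⟨T, hT, W, hW, hd⟩ := hh n
    refine ⟨_, image_mem_map hT, ?_⟩
    rintro _ ⟨x, hx, rfl⟩ _ ⟨y, hy, rfl⟩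
    exact (hd x hx y hy h (mem_of_mem_nhds hW) h (mem_of_mem_nhds hW)).trans hn
  obtain ⟨c, hc⟩ := CompleteSpace.complete hc
  refine ⟨c * h⁻¹, ?_⟩
  have : Tendsto (fun x => x * h * h⁻¹) F (𝓝 (c * h⁻¹)) := Tendsto.mul_const h⁻¹ hc
  simpa [Tendsto] using this

end Group

/-! ### Coding a Polish group by sequences -/

theorem two_inv_pow_succ_add (n : ℕ) : (2⁻¹ : ℝ≥0) ^ (n + 1) + 2⁻¹ ^ (n + 1) = 2⁻¹ ^ n := by
  rw [← two_mul, pow_succ, mul_comm, mul_assoc, inv_mul_cancel₀ two_ne_zero, mul_one]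

section Coding

variable {H : Type*} [Group H]

/-- Two elements are `V`-close if they are so on the left and on the right. -/
def Near (V : Set H) (g h : H) : Prop := g⁻¹ * h ∈ V ∧ g * h⁻¹ ∈ V

open Classical in
/-- The `n`-th approximation of the element coded by a sequence `x`: an entry `j + 1` moves to `D j`
if this is close enough to the present position, and other entries do nothing. -/
noncomputable def approx (U : ℕ → Set H) (D : ℕ → H) (c : ℕ) (x : ℕ → ℕ) : ℕ → H
  | 0 => 1
  | n + 1 =>
    if x n ≠ 0 ∧ Near (U (n + c + 1)) (approx U D c x n) (D (x n - 1)) then D (x n - 1)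
    else approx U D c x n

variable {U : ℕ → Set H} {D : ℕ → H} {c : ℕ}

theorem approx_congr {x y : ℕ → ℕ} : ∀ {n : ℕ}, (∀ i < n, x i = y i) →
    approx U D c x n = approx U D c y n
  | 0, _ => rfl
  | n + 1, h => by
    rw [approx, approx, approx_congr fun i hi => h i (hi.trans n.lt_succ_self), h n n.lt_succ_self]

theorem approx_of_mem_level {x : ℕ → ℕ} {m n : ℕ} (hx : x ∈ level m) (hmn : m ≤ n) :
    approx U D c x n = approx U D c x m := by
  induction n, hmn using Nat.le_induction with
  | base => rfl
  | succ n hmn ih => rw [approx, if_neg (by simp [hx n hmn]), ih]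

/-- The list of candidate values does not mention U. Hence the values relevant to the exceptional
points are known before U is chosen, which avoids a circular construction. -/
theorem approx_mem (x : ℕ → ℕ) (n : ℕ) :
    approx U D c x n = 1 ∨ ∃ i < n, approx U D c x n = D (x i - 1) := by
  induction n with
  | zero => exact Or.inl rfl
  | succ n ih =>
    rw [approx]
    split_ifs
    · exact Or.inr ⟨n, n.lt_succ_self, rfl⟩
    · exact ih.imp_right fun ⟨i, hi, h⟩ => ⟨i, hi.trans n.lt_succ_self, h⟩

section Length

variable {ℓ : H → ℝ≥0} (hℓ : IsLength ℓ) (hU : ∀ n, ∀ h ∈ U n, ℓ h ≤ 2⁻¹ ^ n)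
include hℓ hU

theorem approx_succ_le (x : ℕ → ℕ) (n : ℕ) :
    ℓ ((approx U D c x n)⁻¹ * approx U D c x (n + 1)) ≤ 2⁻¹ ^ (n + c + 1) ∧
      ℓ (approx U D c x n * (approx U D c x (n + 1))⁻¹) ≤ 2⁻¹ ^ (n + c + 1) := by
  rw [approx]
  split_ifs with h
  · exact ⟨hU _ _ h.2.1, hU _ _ h.2.2⟩
  · simp [hℓ.one]

/-- The steps have lengths at most 2^-(n+c+1), 2^-(n+c+2), and so on. Keeping the unused tail of the
geometric series on the left lets the induction close. -/
theorem approx_add_le (x : ℕ → ℕ) (n k : ℕ) :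
    ℓ ((approx U D c x n)⁻¹ * approx U D c x (n + k)) + 2⁻¹ ^ (n + k + c) ≤ 2⁻¹ ^ (n + c) ∧
      ℓ (approx U D c x n * (approx U D c x (n + k))⁻¹) + 2⁻¹ ^ (n + k + c) ≤ 2⁻¹ ^ (n + c) := by
  induction k with
  | zero => simp [hℓ.one]
  | succ k ih =>
    obtain ⟨h1, h2⟩ := approx_succ_le (D := D) (c := c) hℓ hU x (n + k)
    rw [← add_assoc, show n + k + 1 + c = n + k + c + 1 by ring]
    rw [← two_inv_pow_succ_add (n + k + c)] at ih
    constructor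
    · refine le_trans ?_ ih.1
      rw [← add_assoc]
      gcongr
      refine le_trans ?_ ((hℓ.mul_le _ _).trans (add_le_add le_rfl h1))
      simp [mul_assoc]
    · refine le_trans ?_ ih.2
      rw [← add_assoc]
      gcongr
      refine le_trans ?_ ((hℓ.mul_le _ _).trans (add_le_add le_rfl h2))
      simp [mul_assoc]

/-- Both walks pass through the same point at stage n, and each drifts from it by at most 2^-(n+c).
-/
theorem approx_le_of_eq {x y : ℕ → ℕ} {n m m' : ℕ} (h : ∀ i < n, x i = y i) (hm : n ≤ m)
    (hm' : n ≤ m') :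
    ℓ ((approx U D c x m)⁻¹ * approx U D c y m') ≤ 2 * 2⁻¹ ^ (n + c) ∧
      ℓ (approx U D c x m * (approx U D c y m')⁻¹) ≤ 2 * 2⁻¹ ^ (n + c) := by
  obtain ⟨k, rfl⟩ := Nat.exists_eq_add_of_le hm
  obtain ⟨k', rfl⟩ := Nat.exists_eq_add_of_le hm'
  have hx := approx_add_le (D := D) (c := c) hℓ hU x n k
  have hy := approx_add_le (D := D) (c := c) hℓ hU y n k'
  rw [← approx_congr h] at hy
  set g := approx U D c x n
  set a := approx U D c x (n + k)
  set b := approx U D c y (n + k')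
  rw [two_mul]
  constructor
  · calc ℓ (a⁻¹ * b) = ℓ ((g⁻¹ * a)⁻¹ * (g⁻¹ * b)) := by congr 1; group
      _ ≤ ℓ (g⁻¹ * a)⁻¹ + ℓ (g⁻¹ * b) := hℓ.mul_le _ _
      _ = ℓ (g⁻¹ * a) + ℓ (g⁻¹ * b) := by rw [hℓ.inv]
      _ ≤ _ := add_le_add (le_self_add.trans hx.1) (le_self_add.trans hy.1)
  · calc ℓ (a * b⁻¹) = ℓ ((g * a⁻¹)⁻¹ * (g * b⁻¹)) := by congr 1; group
      _ ≤ ℓ (g * a⁻¹)⁻¹ + ℓ (g * b⁻¹) := hℓ.mul_le _ _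
      _ = ℓ (g * a⁻¹) + ℓ (g * b⁻¹) := by rw [hℓ.inv]
      _ ≤ _ := add_le_add (le_self_add.trans hx.2) (le_self_add.trans hy.2)

end Length

/-- Every element that is close to an approximation is a limit of further approximations. -/
theorem exists_tendsto_approx [TopologicalSpace H] [IsTopologicalGroup H] (hD : DenseRange D)
    (hnhds : ∀ n, U n ∈ 𝓝 1) (hinv : ∀ n, ∀ g ∈ U n, g⁻¹ ∈ U n)
    (hmul : ∀ n, ∀ a ∈ U (n + 1), ∀ b ∈ U (n + 1), ∀ c ∈ U (n + 1), a * b * c ∈ U n)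
    (hbasis : ∀ W ∈ 𝓝 (1 : H), ∃ n, U n ⊆ W) (x : ℕ → ℕ) (n : ℕ) (h : H)
    (hh : Near (U (n + c + 2)) (approx U D c x n) h) :
    ∃ y : ℕ → ℕ, (∀ i < n, y i = x i) ∧ Tendsto (approx U D c y) atTop (𝓝 h) := by
  have hone : ∀ n, (1 : H) ∈ U n := fun n => mem_of_mem_nhds (hnhds n)
  have hanti : Antitone U := antitone_nat_of_succ_le fun n h hh => by
    simpa using hmul n h hh 1 (hone _) 1 (hone _)
  have hex : ∀ i, ∃ j, Near (U (i + c + 3)) (D j) h := by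
    intro i
    have c1 : Tendsto (fun u : H => u⁻¹ * h) (𝓝 h) (𝓝 1) := by
      have : Continuous (fun u : H => u⁻¹ * h) := by fun_prop
      simpa using this.tendsto h
    have c2 : Tendsto (fun u : H => u * h⁻¹) (𝓝 h) (𝓝 1) := by
      have : Continuous (fun u : H => u * h⁻¹) := by fun_prop
      simpa using this.tendsto h
    obtain ⟨_, hj, j, rfl⟩ := mem_closure_iff_nhds.1 (hD h) _
      ((c1.eventually (hnhds (i + c + 3))).and (c2.eventually (hnhds (i + c + 3))))
    exact ⟨j, hj⟩
  choose J hJ using hex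
  let y : ℕ → ℕ := fun i => if i < n then x i else J i + 1
  have hyx : ∀ i < n, y i = x i := fun i hi => if_pos hi
  -- The target D (J i) is closer to h than the current position is, so passing through h shows that
  -- the move is within the permitted U (i+c+1) and is carried out.
  have hnear : ∀ i ≥ n, Near (U (i + c + 2)) (approx U D c y i) h := by
    intro i hi
    induction i, hi using Nat.le_induction with
    | base => rwa [approx_congr hyx]
    | succ i hi ih =>
      have hy : y i = J i + 1 := if_neg (not_lt.2 hi)
      rw [approx, if_pos]
      · rw [hy, Nat.add_sub_cancel, show i + 1 + c + 2 = i + c + 3 by ring]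
        exact hJ i
      · rw [hy, Nat.add_sub_cancel]
        refine ⟨Nat.succ_ne_zero _, ?_, ?_⟩
        · have := hmul (i + c + 1) _ ih.1 _ (hanti (Nat.le_succ _) (hinv _ _ (hJ i).1)) 1 (hone _)
          simpa [mul_assoc] using this
        · have := hmul (i + c + 1) _ ih.2 _ (hanti (Nat.le_succ _) (hinv _ _ (hJ i).2)) 1 (hone _)
          simpa [mul_assoc] using this
  refine ⟨y, hyx, ?_⟩
  have hlim : Tendsto (fun i => (approx U D c y i)⁻¹ * h) atTop (𝓝 1) := by
    refine tendsto_def.2 fun W hW => ?_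
    obtain ⟨k, hk⟩ := hbasis W hW
    filter_upwards [eventually_ge_atTop (max n k)] with i hi
    have hi' := max_le_iff.1 hi
    exact hk (hanti (show k ≤ i + c + 2 by omega) (hnear i hi'.1).1)
  simpa using hlim.inv.const_mul h

end Coding

/-! ### The Baire metric on finitely supported sequences -/

theorem nndist_pos_le {x y : NOmega} {n : ℕ} (h : ∀ i < n, x.1 i = y.1 i) :
    nndist (Letter.pos x) (Letter.pos y) ≤ 2⁻¹ ^ n := by
  rw [← NNReal.coe_le_coe]
  change baireDist x.1 y.1 ≤ _
  have := (PiNat.mem_cylinder_iff_dist_le (x := y.1) (y := x.1) (n := n)).1 h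
  simpa [baireDist] using this

theorem nndist_pos_eq {x y : NOmega} (h : x ≠ y) :
    nndist (Letter.pos x) (Letter.pos y) = 2⁻¹ ^ PiNat.firstDiff x.1 y.1 := by
  apply NNReal.coe_injective
  change baireDist x.1 y.1 = _
  rw [baireDist, PiNat.dist_eq_of_ne fun he => h (Subtype.ext he)]
  simp

namespace NOmega

theorem exists_mem_level (x : NOmega) : ∃ n, x.1 ∈ level n := Set.mem_iUnion.1 x.2

/-- The finitely supported sequence that agrees with `x` on the first `n` places. -/
def truncate (x : ℕ → ℕ) (n : ℕ) : NOmega :=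
  ⟨fun i => if i < n then x i else 0, Set.mem_iUnion.2 ⟨n, fun _ hm => if_neg (not_lt.2 hm)⟩⟩

theorem truncate_mem_level (x : ℕ → ℕ) (n : ℕ) : (truncate x n).1 ∈ level n :=
  fun _ hm => if_neg (not_lt.2 hm)

theorem truncate_apply {x : ℕ → ℕ} {n i : ℕ} (h : i < n) : (truncate x n).1 i = x i := if_pos h

/-- The value of the coding at a finitely supported sequence. -/
noncomputable def code {H : Type*} [Group H] (U : ℕ → Set H) (D : ℕ → H) (c : ℕ) (x : NOmega) : H :=
  approx U D c x.1 x.exists_mem_level.choose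

variable {H : Type*} [Group H] {U : ℕ → Set H} {D : ℕ → H} {c : ℕ}

theorem code_eq {x : NOmega} {n : ℕ} (h : x.1 ∈ level n) :
    code U D c x = approx U D c x.1 n := by
  have h' := x.exists_mem_level.choose_spec
  rcases le_total n x.exists_mem_level.choose with hn | hn
  · exact approx_of_mem_level h hn
  · exact (approx_of_mem_level h' hn).symm

theorem code_truncate (x : ℕ → ℕ) (n : ℕ) : code U D c (truncate x n) = approx U D c x n := by
  rw [code_eq (truncate_mem_level x n)]
  exact approx_congr fun _ => truncate_apply

theorem code_of_level_zero {x : NOmega} (h : x.1 ∈ level 0) : code U D c x = 1 := code_eq h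

/-- If n is the first difference, the two walks agree up to stage n. The shift c + 1 compensates for
the factor 2 of the two drifts. -/
theorem code_lipschitz {ℓ : H → ℝ≥0} (hℓ : IsLength ℓ) (hU : ∀ n, ∀ h ∈ U n, ℓ h ≤ 2⁻¹ ^ n)
    (x y : NOmega) :
    ℓ ((code U D (c + 1) x)⁻¹ * code U D (c + 1) y) ≤
        2⁻¹ ^ c * nndist (Letter.pos x) (Letter.pos y) ∧
      ℓ (code U D (c + 1) x * (code U D (c + 1) y)⁻¹) ≤
        2⁻¹ ^ c * nndist (Letter.pos x) (Letter.pos y) := by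
  rcases eq_or_ne x y with rfl | hxy
  · simp [hℓ.one]
  · obtain ⟨m, hm⟩ := x.exists_mem_level
    obtain ⟨m', hm'⟩ := y.exists_mem_level
    rw [nndist_pos_eq hxy]
    set n := PiNat.firstDiff x.1 y.1
    have e := approx_le_of_eq (D := D) (c := c + 1) hℓ hU (x := x.1) (y := y.1) (n := n)
      (m := max m n) (m' := max m' n) (fun i hi => PiNat.apply_eq_of_lt_firstDiff hi)
      (le_max_right _ _) (le_max_right _ _)
    -- Reading both codes at stages beyond n is harmless, since the walks are stationary after the
    -- support.
    rw [code_eq (n := max m n) fun i hi => hm i ((le_max_left _ _).trans hi),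
      code_eq (n := max m' n) fun i hi => hm' i ((le_max_left _ _).trans hi)]
    have e2 : (2 : ℝ≥0) * 2⁻¹ ^ (n + (c + 1)) = 2⁻¹ ^ c * 2⁻¹ ^ n := by
      rw [two_mul, ← add_assoc, two_inv_pow_succ_add, ← pow_add, add_comm]
    rwa [e2] at e

end NOmega

/-! ### Extending homomorphisms to the completion -/

section Extension

variable {X : Type*} [SymmetricExtension X] {H : Type*} [Group H]

/-- A homomorphism that is Lipschitz on letters and whose conjugations by letters are controlled by
the scale does not increase lengths. -/
theorem length_le_norm {ℓ : H → ℝ≥0} (hℓ : IsLength ℓ) (Γ : Scale X) (f : FreeGroup X →* H)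
    (hlip : ∀ a b : Letter X, ℓ ((f a.toFree)⁻¹ * f b.toFree) ≤ nndist a b)
    (hconj : ∀ (a : Letter X) (h : H), ℓ ((f a.toFree)⁻¹ * h * f a.toFree) ≤ Γ a (ℓ h))
    (g : FreeGroup X) : ℓ (f g) ≤ norm Γ g := by
  have key : ∀ w p, Rel Γ w p → ℓ (f (eval w)) ≤ p := by
    intro w p h
    induction h with
    | one x =>
      rw [eval_singleton]
      simpa [show (1 : Letter X).toFree = 1 from rfl] using hlip 1 x
    | two x y =>
      rw [eval_cons, eval_singleton]
      simpa [Letter.toFree_inv] using hlip x⁻¹ y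
    | wrap x y w p _ ih =>
      rw [eval_cons, eval_append, eval_singleton, map_mul, map_mul]
      have h0 := hlip x⁻¹ y
      have h1 := (hconj x⁻¹ (f (eval w))).trans (Γ.mono _ ih)
      have h2 := (hconj y (f (eval w))).trans (Γ.mono _ ih)
      rw [Letter.toFree_inv, map_inv, inv_inv] at h0 h1
      set a := f x.toFree
      set b := f y.toFree
      set u := f (eval w)
      -- The product a u b can be regrouped with u conjugated by a⁻¹ or by b; each grouping bounds
      -- one entry of the min.
      rw [← min_add_add_left, le_min_iff]
      constructor
      · calc ℓ (a * (u * b)) = ℓ ((a * u * a⁻¹) * (a * b)) := by congr 1; group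
          _ ≤ ℓ (a * u * a⁻¹) + ℓ (a * b) := hℓ.mul_le _ _
          _ ≤ _ := by rw [add_comm]; exact add_le_add h0 h1
      · calc ℓ (a * (u * b)) = ℓ ((a * b) * (b⁻¹ * u * b)) := by congr 1; group
          _ ≤ ℓ (a * b) + ℓ (b⁻¹ * u * b) := hℓ.mul_le _ _
          _ ≤ _ := add_le_add h0 h2
    | append u v p q _ _ ihu ihv =>
      rw [eval_append, map_mul]
      exact (hℓ.mul_le _ _).trans (add_le_add ihu ihv)
  refine le_of_forall_gt_imp_ge_of_dense fun r hr => ?_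
  obtain ⟨p, hp, w, hw, rfl⟩ := exists_rel_lt Γ g hr
  exact (key w p hw).trans hp.le

namespace FreeCompletion

variable [TopologicalSpace H] [IsTopologicalGroup H] [PolishSpace H]

/-- A Cauchy filter for Δ_Γ has small left and right quotients, and so does its image in H;
two-sided completeness of H then gives the limits that define the extension. -/
theorem exists_extension (Γ : Scale X) (f : FreeGroup X →* H)
    (hf : ∀ W ∈ 𝓝 (1 : H), ∃ ε : ℝ≥0, 0 < ε ∧ ∀ g, norm Γ g < ε → f g ∈ W) :
    ∃ F : FreeCompletion Γ →* H, Continuous F ∧ ∀ g : MetricFreeGroup Γ, F (of Γ g) = f g := by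
  let f' : MetricFreeGroup Γ →* H := f
  have hlim : ∀ a : FreeCompletion Γ, ∃ c, Tendsto f' (comap (of Γ) (𝓝 a)) (𝓝 c) := by
    intro a
    have hc := cauchy_comap Γ a
    have := hc.1
    have aux : ∀ W ∈ 𝓝 (1 : H), ∃ A ∈ comap (of Γ) (𝓝 a), ∀ g ∈ A, ∀ h ∈ A,
        (f' g)⁻¹ * f' h ∈ W ∧ f' g * (f' h)⁻¹ ∈ W := by
      intro W hW
      obtain ⟨ε, hε, hεW⟩ := hf W hW
      obtain ⟨A, hA, hd⟩ := (Metric.cauchy_iff.1 hc).2 ε (NNReal.coe_pos.2 hε)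
      refine ⟨A, hA, fun g hg h hh => ?_⟩
      obtain ⟨h1, h2⟩ := (dist_lt_iff Γ g h ε).1 (hd g hg h hh)
      have e1 : f' (g⁻¹ * h) ∈ W := hεW _ h1
      have e2 : f' (g * h⁻¹) ∈ W := hεW _ h2
      rw [map_mul, map_inv] at e1 e2
      exact ⟨e1, e2⟩
    refine exists_tendsto_of_cauchy (F := map f' (comap (of Γ) (𝓝 a))) ?_ ?_
    · rw [prod_map_map_eq, tendsto_map'_iff]
      refine tendsto_def.2 fun W hW => ?_
      obtain ⟨A, hA, h⟩ := aux W hW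
      exact mem_of_superset (prod_mem_prod hA hA) fun p hp => (h p.1 hp.1 p.2 hp.2).1
    · rw [prod_map_map_eq, tendsto_map'_iff]
      refine tendsto_def.2 fun W hW => ?_
      obtain ⟨A, hA, h⟩ := aux W hW
      exact mem_of_superset (prod_mem_prod hA hA) fun p hp => (h p.1 hp.1 p.2 hp.2).2
  have hcont := (isDenseInducing_of Γ).continuous_extend hlim
  have hof : ∀ g, (isDenseInducing_of Γ).extend f' (of Γ g) = f' g :=
    (isDenseInducing_of Γ).extend_eq' hlim
  refine ⟨MonoidHom.mk' ((isDenseInducing_of Γ).extend f') fun a b =>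
    (isDenseInducing_of Γ).dense.induction_on₂
      (p := fun a b => (isDenseInducing_of Γ).extend f' (a * b) =
        (isDenseInducing_of Γ).extend f' a * (isDenseInducing_of Γ).extend f' b)
      (isClosed_eq (by fun_prop) (by fun_prop)) (fun a b => ?_) a b, hcont, hof⟩
  rw [← of_mul, hof, hof, hof, map_mul]

instance (Γ : Scale X) : IsTopologicalGroup (FreeCompletion Γ) where

theorem isPolishGroup [Countable X] (Γ : Scale X) : IsPolishGroup (FreeCompletion Γ) := by
  refine ⟨inferInstance, ?_⟩
  have : Countable (FreeGroup X) := Quot.mk_surjective.countable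
  have : Countable (MetricFreeGroup Γ) := this
  have : TopologicalSpace.SeparableSpace (FreeCompletion Γ) :=
    (isDenseInducing_of Γ).separableSpace
  have := UniformSpace.secondCountable_of_separable (FreeCompletion Γ)
  infer_instance

/-- The two-letter words a⁻¹b and ab⁻¹, with their letters matched, bound the two parts of Δ_Γ. -/
theorem dist_of_letter_le (Γ : Scale X) (a b : Letter X) :
    dist (of Γ a.toFree) (of Γ b.toFree) ≤ dist a b := by
  refine (UniformSpace.Completion.dist_eq (α := MetricFreeGroup Γ) _ _).trans_le ?_
  refine NNReal.coe_le_coe (r₁ := Delta Γ _ _) (r₂ := nndist a b) |>.2 (max_le ?_ ?_)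
  · have := norm_le (Rel.two (Γ := Γ) a⁻¹ b)
    rwa [eval_cons, eval_singleton, Letter.inv_inv', Letter.toFree_inv] at this
  · have := norm_le (Rel.two (Γ := Γ) a b⁻¹)
    rwa [eval_cons, eval_singleton, ← nndist_inv_inv, Letter.inv_inv', Letter.inv_inv',
      Letter.toFree_inv, ← inv_inv a.toFree] at this

end FreeCompletion

end Extension

/-! ### Quotients by kernels of open surjections -/

theorem exists_quotient_of_isOpenQuotientMap {G H : Type*} [Group G] [TopologicalSpace G] [Group H]
    [TopologicalSpace H] (F : G →* H) (hF : IsOpenQuotientMap F) :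
    ∃ (N : Subgroup G) (_ : N.Normal), Nonempty ((G ⧸ N) ≃ₜ* H) := by
  refine ⟨F.ker, inferInstance, ⟨?_⟩⟩
  let e := QuotientGroup.quotientKerEquivOfSurjective F hF.surjective
  have he : ⇑e ∘ (QuotientGroup.mk : G → G ⧸ F.ker) = F := rfl
  have hq : Topology.IsQuotientMap (QuotientGroup.mk : G → G ⧸ F.ker) :=
    QuotientGroup.isQuotientMap_mk _
  refine { e with
    continuous_toFun := hq.continuous_iff.2 (he ▸ hF.continuous)
    continuous_invFun := hF.isQuotientMap.continuous_iff.2 ?_ }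
  have : ⇑e.symm ∘ F = QuotientGroup.mk := by
    funext g
    exact e.symm_apply_apply (g : G ⧸ F.ker)
  change Continuous (⇑e.symm ∘ F)
  rw [this]
  exact hq.continuous

/-! ### Surjective universality -/

section Universal

instance : Countable NOmega := by
  have : (⋃ n, level n).Countable := Set.countable_iUnion fun n => by
    refine (Set.countable_range fun (l : List ℕ) (i : ℕ) => l.getD i 0).mono fun x hx => ?_
    refine ⟨(List.range n).map x, funext fun i => ?_⟩
    rcases lt_or_ge i n with h | h
    · simp [List.getD, h]
    · simp [List.getD, show x i = 0 from hx i h, h]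
  exact this.to_subtype

open NOmega

variable {H : Type*}

/-- The values used by the codings of the exceptional points of index `n + 3`. -/
def exceptionalValues (Γ : Scale NOmega) (K : ℕ) (D : ℕ → H) (n : ℕ) : Set H :=
  ⋃ m ∈ {m | 0 < m ∧ m + K + 5 < n + 3}, ⋃ x ∈ exceptionalSet Γ K m (n + 3),
    (fun i => D (x.1 i - 1)) '' Set.Iio m

theorem finite_exceptionalValues {Γ : Scale NOmega} {K : ℕ} (D : ℕ → H)
    (h2 : ∀ m k : ℕ, 0 < m → m + K + 5 < k → (exceptionalSet Γ K m k).Finite) (n : ℕ) :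
    (exceptionalValues Γ K D n).Finite :=
  Set.Finite.biUnion ((Set.finite_lt_nat (n + 3)).subset fun m hm => by
    have := hm.2
    change m < n + 3
    omega) fun m hm =>
      (h2 m (n + 3) hm.1 hm.2).biUnion fun _ _ => (Set.finite_lt_nat m).image _

variable [Group H]

/-- Conjugation by the coded elements is controlled by the scale. -/
theorem conj_code_le {Γ : Scale NOmega} {K : ℕ}
    (h1 : ∀ m : ℕ, 0 < m → ∀ x : NOmega, x.1 ∈ level m \ level (m - 1) →
      ∀ r : ℝ≥0, 2⁻¹ ^ (m + K + 5) < r → ∃ y : NOmega, y.1 ∈ level (m - 1) ∧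
        min (2⁻¹ ^ (K + 3)) (Γ (.pos y) r + 2⁻¹ ^ K * nndist (Letter.pos x) (Letter.pos y)) ≤
          Γ (.pos x) r)
    (h3 : ∀ m : ℕ, 0 < m → ∀ x : NOmega, x.1 ∈ level m \ level (m - 1) →
      ∀ r : ℝ≥0, r ≤ 2⁻¹ ^ (m + K + 5) → 8 * r ≤ Γ (.pos x) r)
    {U : ℕ → Set H} {D : ℕ → H} {ℓ : H → ℝ≥0} (hℓ : IsLength ℓ)
    (hpos : ∀ h, ℓ h = 0 → h = 1) (hbd : ∀ h, ℓ h ≤ 2⁻¹ ^ (K + 3))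
    (hU : ∀ n, ∀ h ∈ U n, ℓ h ≤ 2⁻¹ ^ n) (hU' : ∀ n h, ℓ h ≤ 2⁻¹ ^ (n + 1) → h ∈ U n)
    (hconj : ∀ n, K + 4 ≤ n → ∀ d ∈ exceptionalValues Γ K D n, ∀ u ∈ U (n + 1),
      d⁻¹ * u * d ∈ U n ∧ d * u * d⁻¹ ∈ U n) (m : ℕ) :
    ∀ x : NOmega, x.1 ∈ level m → ∀ h : H,
      ℓ ((code U D (K + 2) x)⁻¹ * h * code U D (K + 2) x) ≤ Γ (.pos x) (ℓ h) ∧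
      ℓ (code U D (K + 2) x * h * (code U D (K + 2) x)⁻¹) ≤ Γ (.pos x) (ℓ h) := by
  induction m with
  | zero =>
    intro x hx h
    rw [code_of_level_zero hx]
    simpa using Γ.le_apply _ _
  | succ m ih =>
    intro x hx h
    by_cases hxm : x.1 ∈ level m
    · exact ih x hxm h
    have hx' : x.1 ∈ level (m + 1) \ level (m + 1 - 1) := ⟨hx, hxm⟩
    -- The first entry of the min bounds every length in H. For the second, conjugation by x is
    -- conjugation by y corrected by a factor on each side; each correction costs 2^-(K+1) d(x, y),
    -- in total 2^-K d(x, y).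
    have of_min : (∃ y : NOmega, y.1 ∈ level (m + 1 - 1) ∧
        min (2⁻¹ ^ (K + 3))
          (Γ (.pos y) (ℓ h) + 2⁻¹ ^ K * nndist (Letter.pos x) (Letter.pos y)) ≤
            Γ (.pos x) (ℓ h)) →
        ℓ ((code U D (K + 2) x)⁻¹ * h * code U D (K + 2) x) ≤ Γ (.pos x) (ℓ h) ∧
        ℓ (code U D (K + 2) x * h * (code U D (K + 2) x)⁻¹) ≤ Γ (.pos x) (ℓ h) := by
      rintro ⟨y, hy, hle⟩
      obtain ⟨i1, i2⟩ := ih y hy h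
      obtain ⟨l1, l2⟩ := code_lipschitz (D := D) (c := K + 1) hℓ hU x y
      rw [show K + 1 + 1 = K + 2 from rfl] at l1 l2
      set a := code U D (K + 2) x
      set b := code U D (K + 2) y
      have hK := congrArg (· * nndist (Letter.pos x) (Letter.pos y)) (two_inv_pow_succ_add K)
      simp only [add_mul] at hK
      refine ⟨(le_min (hbd _) ?_).trans hle, (le_min (hbd _) ?_).trans hle⟩
      · calc ℓ (a⁻¹ * h * a) = ℓ ((a⁻¹ * b) * ((b⁻¹ * h * b) * (a⁻¹ * b)⁻¹)) := by
              congr 1; group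
          _ ≤ ℓ (a⁻¹ * b) + (ℓ (b⁻¹ * h * b) + ℓ (a⁻¹ * b)) :=
              (hℓ.mul_le _ _).trans (add_le_add le_rfl (hℓ.inv (a⁻¹ * b) ▸ hℓ.mul_le _ _))
          _ ≤ _ := add_le_add l1 (add_le_add i1 l1)
          _ = _ := by rw [← hK]; ring
      · calc ℓ (a * h * a⁻¹) = ℓ ((a * b⁻¹) * ((b * h * b⁻¹) * (a * b⁻¹)⁻¹)) := by
              congr 1; group
          _ ≤ ℓ (a * b⁻¹) + (ℓ (b * h * b⁻¹) + ℓ (a * b⁻¹)) :=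
              (hℓ.mul_le _ _).trans (add_le_add le_rfl (hℓ.inv (a * b⁻¹) ▸ hℓ.mul_le _ _))
          _ ≤ _ := add_le_add l2 (add_le_add i2 l2)
          _ = _ := by rw [← hK]; ring
    rcases lt_or_ge (2⁻¹ ^ (m + 1 + K + 5)) (ℓ h) with hr | hr
    · exact of_min (h1 (m + 1) m.succ_pos x hx' _ hr)
    -- Length zero lies in no dyadic interval and is settled by faithfulness of ℓ.
    rcases eq_or_ne (ℓ h) 0 with h0 | h0
    · obtain rfl := hpos h h0
      simp [hℓ.one]
    by_cases hex : ∃ y : NOmega, y.1 ∈ level (m + 1 - 1) ∧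
        min (2⁻¹ ^ (K + 3))
          (Γ (.pos y) (ℓ h) + 2⁻¹ ^ K * nndist (Letter.pos x) (Letter.pos y)) ≤
            Γ (.pos x) (ℓ h)
    · exact of_min hex
    push Not at hex
    have hr0 : (0 : ℝ≥0) < 2⁻¹ := by positivity
    have hr1 : (2⁻¹ : ℝ≥0) < 1 := by
      rw [← NNReal.coe_lt_coe]; norm_num
    obtain ⟨k, hk1, hk2⟩ := exists_nat_pow_near_of_lt_one (pos_iff_ne_zero.2 h0)
      (hr.trans (pow_le_one₀ hr0.le hr1.le)) hr0 hr1
    have hk : m + 1 + K + 5 < k + 1 :=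
      (pow_right_strictAnti₀ hr0 hr1).lt_iff_gt.1 (hk1.trans_le hr)
    -- Now 2^-(n+3) < ℓ h ≤ 2^-(n+2): the lower bound makes x exceptional of index n + 3, the upper
    -- one puts h in U (n+1).
    obtain ⟨n, rfl⟩ : ∃ n, k = n + 2 := ⟨k - 2, by omega⟩
    have hxE : x ∈ exceptionalSet Γ K (m + 1) (n + 3) := ⟨hx', ℓ h, ⟨hk1, hr⟩, hex⟩
    have hh : h ∈ U (n + 1) := hU' _ _ hk2
    -- Conjugates of h will lie in U n, hence have length at most 2^-n = 8 · 2^-(n+3) < 8 ℓ h; this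
    -- is what the constant 8 in (S3) pays for.
    have h8 : (2⁻¹ : ℝ≥0) ^ n ≤ Γ (.pos x) (ℓ h) := by
      refine le_trans ?_ (h3 (m + 1) m.succ_pos x hx' _ hr)
      calc (2⁻¹ : ℝ≥0) ^ n = 8 * 2⁻¹ ^ (n + 2 + 1) := by
            rw [pow_succ, pow_add]
            rw [← NNReal.coe_inj]; push_cast; ring
        _ ≤ _ := by gcongr
    rw [code_eq hx]
    rcases approx_mem (U := U) (D := D) (c := K + 2) x.1 (m + 1) with e | ⟨i, hi, e⟩
    · rw [e]
      simpa using Γ.le_apply _ _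
    · have := hconj n (by omega) (D (x.1 i - 1))
        (Set.mem_biUnion (show m + 1 ∈ {m | 0 < m ∧ m + K + 5 < n + 3} from
          ⟨m.succ_pos, hk⟩) (Set.mem_biUnion hxE ⟨i, hi, rfl⟩)) h hh
      rw [e]
      exact ⟨(hU _ _ this.1).trans h8, (hU _ _ this.2).trans h8⟩

/-- The points of the completion given by infinite sequences. -/
theorem exists_limit_letter (Γ : Scale NOmega) (y : ℕ → ℕ) (n : ℕ) (x : NOmega)
    (hx : ∀ i < n, y i = x.1 i) :
    ∃ z : FreeCompletion Γ, Tendsto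
      (fun k => FreeCompletion.of Γ (Letter.pos (truncate y k)).toFree) atTop (𝓝 z) ∧
      dist z (FreeCompletion.of Γ (Letter.pos x).toFree) ≤ (2⁻¹ : ℝ≥0) ^ n := by
  have hle : ∀ (i : ℕ) (a b : NOmega), (∀ j < i, a.1 j = b.1 j) →
      dist (FreeCompletion.of Γ (Letter.pos a).toFree)
        (FreeCompletion.of Γ (Letter.pos b).toFree) ≤ (2⁻¹ : ℝ≥0) ^ i := fun i a b hab =>
    (FreeCompletion.dist_of_letter_le Γ _ _).trans (by exact_mod_cast nndist_pos_le hab)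
  have htr : ∀ {i k l : ℕ}, i ≤ k → i ≤ l → ∀ j < i,
      (truncate y k).1 j = (truncate y l).1 j := fun hk hl j hj => by
    rw [truncate_apply (hj.trans_le hk), truncate_apply (hj.trans_le hl)]
  -- Consecutive truncations of y differ first at place i or later, so their letters are within
  -- 2^-i.
  have hc : CauchySeq (fun k => FreeCompletion.of Γ (Letter.pos (truncate y k)).toFree) :=
    cauchySeq_of_le_geometric (2⁻¹ : ℝ) 1 (by norm_num) fun i =>
      (hle i _ _ (htr le_rfl (Nat.le_succ i))).trans (by simp)
  obtain ⟨z, hz⟩ := cauchySeq_tendsto_of_complete hc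
  refine ⟨z, hz, le_of_tendsto (hz.dist tendsto_const_nhds) ?_⟩
  filter_upwards [eventually_ge_atTop n] with k hk
  exact hle n _ _ fun j hj => (truncate_apply (hj.trans_le hk)).trans (hx j hj)

/-- The free group alone reaches only a countable subgroup of H. The remaining elements come from
letters of infinite sequences, which exist only in the completion. -/
theorem exists_isOpenQuotientMap {Γ : Scale NOmega}
    (hsymm : ∀ (x : NOmega) (r : ℝ≥0), Γ (.pos x) r = Γ (Letter.pos x)⁻¹ r) {K : ℕ}
    (h1 : ∀ m : ℕ, 0 < m → ∀ x : NOmega, x.1 ∈ level m \ level (m - 1) →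
      ∀ r : ℝ≥0, 2⁻¹ ^ (m + K + 5) < r → ∃ y : NOmega, y.1 ∈ level (m - 1) ∧
        min (2⁻¹ ^ (K + 3)) (Γ (.pos y) r + 2⁻¹ ^ K * nndist (Letter.pos x) (Letter.pos y)) ≤
          Γ (.pos x) r)
    (h2 : ∀ m k : ℕ, 0 < m → m + K + 5 < k → (exceptionalSet Γ K m k).Finite)
    (h3 : ∀ m : ℕ, 0 < m → ∀ x : NOmega, x.1 ∈ level m \ level (m - 1) →
      ∀ r : ℝ≥0, r ≤ 2⁻¹ ^ (m + K + 5) → 8 * r ≤ Γ (.pos x) r)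
    [TopologicalSpace H] [IsTopologicalGroup H] [PolishSpace H] :
    ∃ F : FreeCompletion Γ →* H, IsOpenQuotientMap F := by
  obtain ⟨D, hD⟩ := TopologicalSpace.exists_dense_seq H
  -- The delay K + 4 serves twice: it caps all lengths below 2^-(K+3), and it lets a walk with step
  -- parameter K + 2 head for any element of H from the start.
  obtain ⟨U, huniv, hnhds, hinv, hmul, hconj, hbasis⟩ :=
    exists_nhds_chain (exceptionalValues Γ K D) (finite_exceptionalValues D h2) (K + 4)
  obtain ⟨ℓ, hℓ, hU, hU'⟩ := exists_isLength U (huniv 0 (Nat.zero_le _))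
    (fun n => mem_of_mem_nhds (hnhds n)) hinv hmul
  have hr0 : (0 : ℝ≥0) < 2⁻¹ := by positivity
  have hr1 : (2⁻¹ : ℝ≥0) < 1 := by
    rw [← NNReal.coe_lt_coe]; norm_num
  have hbd4 : ∀ h, ℓ h ≤ 2⁻¹ ^ (K + 4) := fun h =>
    hU _ h (by rw [huniv _ le_rfl]; trivial)
  have hbd : ∀ h, ℓ h ≤ 2⁻¹ ^ (K + 3) := fun h =>
    (hbd4 h).trans (pow_le_pow_of_le_one hr0.le hr1.le (Nat.le_succ _))
  have hbd1 : ∀ h, ℓ h ≤ 1 := fun h => (hbd h).trans (pow_le_one₀ hr0.le hr1.le)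
  have hpos : ∀ h, ℓ h = 0 → h = 1 := by
    intro h h0
    by_contra hne
    obtain ⟨n, hn⟩ := hbasis _ (isOpen_compl_singleton.mem_nhds (Ne.symm hne))
    exact hn (hU' n h (by rw [h0]; exact zero_le)) rfl
  let f : FreeGroup NOmega →* H := FreeGroup.lift (code U D (K + 2))
  have hfp : ∀ x, f (Letter.pos x).toFree = code U D (K + 2) x := fun x =>
    FreeGroup.lift_apply_of
  have hfn : ∀ x, f (Letter.neg x).toFree = (code U D (K + 2) x)⁻¹ := fun x => by
    rw [← hfp, ← map_inv]; rfl
  have hfo : f (Letter.one : Letter NOmega).toFree = 1 := map_one f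
  have hlipx : ∀ x y : NOmega,
      ℓ ((code U D (K + 2) x)⁻¹ * code U D (K + 2) y) ≤ nndist (Letter.pos x) (Letter.pos y) ∧
      ℓ (code U D (K + 2) x * (code U D (K + 2) y)⁻¹) ≤
        nndist (Letter.pos x) (Letter.pos y) := by
    intro x y
    obtain ⟨l1, l2⟩ := code_lipschitz (D := D) (c := K + 1) hℓ hU x y
    have : 2⁻¹ ^ (K + 1) * nndist (Letter.pos x) (Letter.pos y) ≤
        nndist (Letter.pos x) (Letter.pos y) :=
      mul_le_of_le_one_left zero_le (pow_le_one₀ hr0.le hr1.le)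
    exact ⟨l1.trans this, l2.trans this⟩
  -- Letters of different kinds are at distance 1, which already bounds every length.
  have hlip : ∀ a b : Letter NOmega, ℓ ((f a.toFree)⁻¹ * f b.toFree) ≤ nndist a b := by
    rintro (_ | x | x) (_ | y | y)
    · simp [hℓ.one]
    · exact hbd1 _
    · exact hbd1 _
    · exact hbd1 _
    · rw [hfp, hfp]; exact (hlipx x y).1
    · exact hbd1 _
    · exact hbd1 _
    · exact hbd1 _
    · rw [hfn, hfn, inv_inv]
      exact (hlipx x y).2
  have hconj' : ∀ (a : Letter NOmega) (h : H),
      ℓ ((f a.toFree)⁻¹ * h * f a.toFree) ≤ Γ a (ℓ h) := by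
    have key := conj_code_le h1 h3 hℓ hpos hbd hU hU' hconj
    rintro (_ | x | x) h
    · rw [hfo]; simpa using Γ.le_apply _ _
    · obtain ⟨m, hm⟩ := x.exists_mem_level
      rw [hfp]; exact (key m x hm h).1
    · obtain ⟨m, hm⟩ := x.exists_mem_level
      rw [hfn, inv_inv]
      exact (key m x hm h).2.trans (hsymm x _).le
  have hnorm := length_le_norm hℓ Γ f hlip hconj'
  obtain ⟨F, hFc, hF⟩ := FreeCompletion.exists_extension Γ f fun W hW => by
    obtain ⟨n, hn⟩ := hbasis W hW
    exact ⟨2⁻¹ ^ (n + 1), by positivity, fun g hg => hn (hU' n _ ((hnorm g).trans hg.le))⟩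
  have hFx : ∀ x : NOmega, F (FreeCompletion.of Γ (Letter.pos x).toFree) = code U D (K + 2) x :=
    fun x => (hF _).trans (hfp x)
  -- The first n entries are 0, so the walk waits at 1 and then converges to h; continuity of F
  -- identifies F z with that limit.
  have hlimit : ∀ (n : ℕ) (h : H), h ∈ U (n + (K + 2) + 2) →
      ∃ z : FreeCompletion Γ, F z = h ∧
        dist z (FreeCompletion.of Γ (Letter.pos (truncate 0 n)).toFree) ≤ (2⁻¹ : ℝ≥0) ^ n := by
    intro n h hh
    have hzero : approx U D (K + 2) 0 n = 1 :=
      approx_of_mem_level (m := 0) (fun _ _ => rfl) (Nat.zero_le n)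
    obtain ⟨y, hy, hlim⟩ := exists_tendsto_approx (c := K + 2) hD hnhds hinv hmul hbasis 0 n h (by
      rw [hzero]
      exact ⟨by simpa using hh, by simpa using hinv _ _ hh⟩)
    obtain ⟨z, hz, hd⟩ := exists_limit_letter Γ y n (truncate 0 n) fun i hi =>
      (hy i hi).trans (truncate_apply hi).symm
    refine ⟨z, tendsto_nhds_unique ((hFc.tendsto z).comp hz) (hlim.congr fun k => ?_), hd⟩
    exact ((hFx _).trans (code_truncate y k)).symm
  have hsurj : Function.Surjective F := fun h => by
    obtain ⟨z, hz, -⟩ := hlimit 0 h (by rw [huniv _ (by omega)]; trivial)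
    exact ⟨z, hz⟩
  refine ⟨F, hsurj, hFc, ?_⟩
  refine IsTopologicalGroup.isOpenMap_iff_nhds_one.2 fun W hW => ?_
  rw [mem_map] at hW
  have hz0 : ∀ n, truncate 0 n = truncate 0 0 := fun n => Subtype.ext (by
    funext i; simp [truncate])
  -- The letter of the zero sequence differs from the identity but is in the kernel of F. The points
  -- z found above are near it, so they are translated by o⁻¹ into a neighbourhood of 1 without
  -- changing their images.
  set o := FreeCompletion.of Γ (Letter.pos (truncate 0 0)).toFree
  have hFo : F o = 1 := (hFx _).trans (code_truncate 0 0)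
  have ht : Tendsto (fun z => o⁻¹ * z) (𝓝 o) (𝓝 1) := by
    have : Continuous (fun z : FreeCompletion Γ => o⁻¹ * z) := by fun_prop
    simpa using this.tendsto o
  obtain ⟨ε, hε, hball⟩ := Metric.mem_nhds_iff.1 (ht hW)
  obtain ⟨n, hn⟩ := exists_pow_lt_of_lt_one hε (show (2⁻¹ : ℝ) < 1 by norm_num)
  refine mem_of_superset (hnhds (n + (K + 2) + 2)) fun h hh => ?_
  obtain ⟨z, rfl, hd⟩ := hlimit n h hh
  rw [hz0] at hd
  have := hball (Metric.mem_ball.2 (hd.trans_lt (by simpa using hn)))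
  simpa [hFo] using this

end Universal

end DingGao

theorem mainTheorem1 (Γ : DingGao.Scale DingGao.NOmega)
    (hsymm : ∀ (x : DingGao.NOmega) (r : ℝ≥0),
      Γ (DingGao.Letter.pos x) r = Γ (DingGao.Letter.pos x)⁻¹ r)
    (hK : ∃ K : ℕ,
      -- (S1)
      (∀ m : ℕ, 0 < m → ∀ x : DingGao.NOmega, x.1 ∈ DingGao.level m \ DingGao.level (m - 1) →
        ∀ r : ℝ≥0, 2⁻¹ ^ (m + K + 5) < r →
          ∃ y : DingGao.NOmega, y.1 ∈ DingGao.level (m - 1) ∧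
            min (2⁻¹ ^ (K + 3)) (Γ (DingGao.Letter.pos y) r +
              2⁻¹ ^ K * nndist (DingGao.Letter.pos x) (DingGao.Letter.pos y)) ≤
                Γ (DingGao.Letter.pos x) r) ∧
      -- (S2)
      (∀ m k : ℕ, 0 < m → m + K + 5 < k → (DingGao.exceptionalSet Γ K m k).Finite) ∧
      -- (S3)
      (∀ m : ℕ, 0 < m → ∀ x : DingGao.NOmega, x.1 ∈ DingGao.level m \ DingGao.level (m - 1) →
        ∀ r : ℝ≥0, r ≤ 2⁻¹ ^ (m + K + 5) → 8 * r ≤ Γ (DingGao.Letter.pos x) r)) :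
    DingGao.IsSurjectivelyUniversal.{0, v} (DingGao.FreeCompletion Γ) := by
  obtain ⟨K, h1, h2, h3⟩ := hK
  refine ⟨DingGao.FreeCompletion.isPolishGroup Γ, fun H _ _ hH => ?_⟩
  have := hH.isTopologicalGroup
  have := hH.polishSpace
  obtain ⟨F, hF⟩ := DingGao.exists_isOpenQuotientMap (H := H) hsymm h1 h2 h3
  exact DingGao.exists_quotient_of_isOpenQuotientMap F hF
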